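/- Let $p_{\rm e}(u)=(1+u)(1-34u+u^2)$ and $R(u)=-108\,u(1-u)^4/p_{\rm e}(u)^2$, and for $k\in\mathbb{Z}$ let $(a)_k$ denote the rising factorial: $(a)_k=a(a+1)\cdots(a+k-1)$ for $k\ge0$ and $(a)_k=[(a+k)_{-k}]^{-1}$ for $k<0$. For $(n,m)\in\mathbb{Z}^2$ put $$d^m_n=(-1)^{m+n}\,3^{3m}\,\frac{(\frac5{12})_{m-n}\,(\frac{13}{12})_{m+n}}{(\frac14)_m\,(\frac54)_m},$$ which is nonzero. Then for every $(n,m)\in\mathbb{Z}^2$ there are unique rational functions $r^m_n$ and $\overline r^m_n$ with complex coefficients such that, for all complex $u$ in a neighborhood of $0$ (with principal powers of $p_{\rm e}(u)$, where $p_{\rm e}(0)=1$), $${}_2F_1\Bigl(-\tfrac1{24}-\tfrac m2-\tfrac n2,\ \tfrac{11}{24}-\tfrac m2-\tfrac n2;\ \tfrac34-m;\ R(u)\Bigr)=p_{\rm e}(u)^{-1/12-m-n}\,r^m_n(u),$$ $${}_2F_1\Bigl(\tfrac5{24}+\tfrac m2-\tfrac n2,\ \tfrac{17}{24}+\tfrac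 m2-\tfrac n2;\ \tfrac54+m;\ R(u)\Bigr)=p_{\rm e}(u)^{5/12+m-n}\,(1-u)^{-1-4m}\,\overline r^m_n(u).$$ Moreover: (i) If $n,m\ge0$, then $r^m_n$ is a polynomial in $u$ of degree $3n+2m$, its coefficient of $u^0$ is $1$, and its coefficient of $u^{3n+2m}$ is $d^m_n$. (ii) For every $(n,m)\in\mathbb{Z}^2$, $r^m_n(0)=1$ and $r^m_n(u)\sim d^m_n\,u^{3n+2m}$ as $u\to\infty$. (iii) For every $(n,m)\in\mathbb{Z}^2$, as rational functions, $$\overline r^m_n(u)=(d^m_n)^{-1}\,u^{3n+2m}\,r^m_n(1/u).$$ In particular, if $n,m\ge0$, $\overline r^m_n$ is $(d^m_n)^{-1}$ times the polynomial obtained from $r^m_n$ by reversing the order of its coefficients, and it equals $1$ at $u=0$. -/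

import Mathlib

open Filter Topology

noncomputable section

/-- The polynomial function `p_e(u) = (1 + u)(1 - 34 u + u ^ 2)`. -/
def octPe (u : ℂ) : ℂ := (1 + u) * (1 - 34 * u + u ^ 2)

/-- The polynomial function `p_v(u) = u (1 - u) ^ 4`. -/
def octPv (u : ℂ) : ℂ := u * (1 - u) ^ 4

/-- The rational map of degree six `R(u) = -108 p_v(u) / p_e(u) ^ 2`. -/
def octMap (u : ℂ) : ℂ := -108 * octPv u / octPe u ^ 2

/-- The value at `u` of a rational function with complex coefficients. -/
def ratValue (r : RatFunc ℂ) (u : ℂ) : ℂ := r.eval (RingHom.id ℂ) u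

/-- `r` is a rational function which satisfies, on a neighborhood of `u = 0`, the relation that
defines the octahedral function `r^m_n`. The complex power is the principal one; its base equals
`1` at `u = 0`. -/
def IsOctahedral (n m : ℤ) (r : RatFunc ℂ) : Prop :=
  ∀ᶠ u in 𝓝 (0 : ℂ),
    ₂F₁ (-1 / 24 - (m : ℂ) / 2 - (n : ℂ) / 2) (11 / 24 - (m : ℂ) / 2 - (n : ℂ) / 2)
        (3 / 4 - (m : ℂ)) (octMap u)
      = octPe u ^ (-1 / 12 - (m : ℂ) - (n : ℂ)) * ratValue r u

/-- `r` is a rational function which satisfies, on a neighborhood of `u = 0`, the relation that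
defines the conjugate octahedral function `\bar r^m_n`. -/
def IsOctahedralConj (n m : ℤ) (r : RatFunc ℂ) : Prop :=
  ∀ᶠ u in 𝓝 (0 : ℂ),
    ₂F₁ (5 / 24 + (m : ℂ) / 2 - (n : ℂ) / 2) (17 / 24 + (m : ℂ) / 2 - (n : ℂ) / 2)
        (5 / 4 + (m : ℂ)) (octMap u)
      = octPe u ^ (5 / 12 + (m : ℂ) - (n : ℂ)) * (1 - u) ^ (-1 - 4 * m) * ratValue r u

/-- The rising factorial `(a)_k` for every integer `k`: it is `a (a + 1) ⋯ (a + k - 1)` for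
`k ≥ 0`, and `((a + k)_{-k})⁻¹` for `k < 0`. -/
def risingFact (a : ℂ) : ℤ → ℂ
  | Int.ofNat k => (ascPochhammer ℂ k).eval a
  | Int.negSucc k => ((ascPochhammer ℂ (k + 1)).eval (a - ((k : ℂ) + 1)))⁻¹

/-- The constant `d^m_n`. -/
def octLead (n m : ℤ) : ℂ :=
  (-1) ^ (m + n) * 3 ^ (3 * m) *
    (risingFact (5 / 12) (m - n) * risingFact (13 / 12) (m + n)) /
      (risingFact (1 / 4) m * risingFact (5 / 4) m)

end

/-!
Write `p_f = 1 + 14 u + u ^ 2`. The degree six map `R` satisfies `1 - R = p_f ^ 3 / p_e ^ 2` and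
`u (1 - u) p_e R' = p_f ^ 2 R`, and it is invariant under `u ↦ 1 / u`. The Gauss functions of the
theorem all have the form `halfF β c = ₂F₁(β / 2, β / 2 + 1 / 2; c; ·)`, with
`(β, c) = (-1/12 - m - n, 3/4 - m)` for `r^m_n` and `(β, c) = (5/12 + m - n, 5/4 + m)` for the
conjugate.

A function `f` is called a pullback (`IsPullback`) if `halfF β c (R u) = p_e(u) ^ β f(u)` near the
origin. Four contiguity relations of `₂F₁`, each a first order differential operator, change
`(β, c)` to `(β + 1, c)`, `(β - 1, c)`, `(β - 1, c - 1)` and `(β + 1, c + 1)`. Because of the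
identities for `R`, they become first order operators with rational coefficients on `f`
(`raiseBeta`, `lowerBeta`, `raiseBoth`). They realize the steps `n ± 1` and `m ± 1` of the index
lattice, and their constants never vanish, by the fractional parts of `β` and `c` (`NonResonant`). So
rationality spreads from `n = m = 0` to all of `ℤ × ℤ`.

For `n = m = 0`, raising and lowering `β` gives a second order equation for `f`, which reads
`u g'' = -κ g'` with `κ = 3/4`, `g = f`, and with `κ = 5/4`, `g = (1 - u) f`, respectively. A
function `g` analytic at the origin that satisfies it is constant, so `r^0_0` and its conjugate
are `1`.

The inversion `u ↦ 1 / u` interchanges the two local solutions of the hypergeometric equation at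
`R = 0`. Accordingly the operators for `r` and those for the conjugate are intertwined by
`r ↦ (d^m_n)⁻¹ u ^ (3 n + 2 m) r(1 / u)`, the recurrences of `d^m_n` being exactly the constants
that come up (`raiseBeta_inversion` and its companions, `conjFactor_mul`). Hence relation (iii) is
carried along the induction (`exists_isOctPair`). The behaviour of `r` at infinity is then the
value `1` of the conjugate at the origin. The steps `n + 1` and `m + 1` use polynomial operators,
so `r` is a polynomial for `n, m ≥ 0`; its degree and leading coefficient are read off from the
behaviour at infinity.
-/

/-! ### Contiguity relations of the Gauss hypergeometric function -/

theorem mul_eval_add_one_ascPochhammer (a : ℂ) (k : ℕ) :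
    a * (ascPochhammer ℂ k).eval (a + 1) = (a + k) * (ascPochhammer ℂ k).eval a := by
  have h := ascPochhammer_succ_eval k a
  rw [ascPochhammer_succ_left] at h
  simp only [Polynomial.eval_mul, Polynomial.eval_X, Polynomial.eval_comp, Polynomial.eval_add,
    Polynomial.eval_one] at h
  rw [h, mul_comm]

theorem ascPochhammer_sub_one_succ_eval (a : ℂ) (k : ℕ) :
    (ascPochhammer ℂ (k + 1)).eval (a - 1) = (a - 1) * (ascPochhammer ℂ k).eval a := by
  simp [ascPochhammer_succ_left]

/-- The coefficients of the Gauss series `₂F₁`. -/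
noncomputable def gaussCoeff (a b c : ℂ) (k : ℕ) : ℂ :=
  (k.factorial : ℂ)⁻¹ * (ascPochhammer ℂ k).eval a * (ascPochhammer ℂ k).eval b *
    ((ascPochhammer ℂ k).eval c)⁻¹

theorem gaussCoeff_zero (a b c : ℂ) : gaussCoeff a b c 0 = 1 := by simp [gaussCoeff]

/-- None of the parameters is a nonpositive integer: the hypergeometric series is then well-defined,
does not terminate, and has radius of convergence `1`. -/
def GenericParams (a b c : ℂ) : Prop := ∀ k : ℕ, (k : ℂ) ≠ -a ∧ (k : ℂ) ≠ -b ∧ (k : ℂ) ≠ -c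

theorem GenericParams.eval_ne_zero {a b c : ℂ} (h : GenericParams a b c) (k : ℕ) :
    (ascPochhammer ℂ k).eval c ≠ 0 := by
  rw [Ne, ascPochhammer_eval_eq_zero_iff]
  push Not
  exact fun j _ => (h j).2.2

theorem GenericParams.add_ne_zero {a b c : ℂ} (h : GenericParams a b c) (k : ℕ) : c + k ≠ 0 :=
  fun h0 => (h k).2.2 (by linear_combination h0)

theorem hasFPowerSeriesOnBall_ordinaryHypergeometric {a b c : ℂ} (h : GenericParams a b c) :
    HasFPowerSeriesOnBall (₂F₁ a b c : ℂ → ℂ) (ordinaryHypergeometricSeries ℂ a b c) 0 1 := by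
  have hr := ordinaryHypergeometricSeries_radius_eq_one ℂ a b c h
  have := (ordinaryHypergeometricSeries ℂ a b c).hasFPowerSeriesOnBall (by rw [hr]; exact one_pos)
  rwa [hr] at this

theorem analyticAt_ordinaryHypergeometric {a b c : ℂ} (h : GenericParams a b c) {x : ℂ}
    (hx : ‖x‖ < 1) : AnalyticAt ℂ (₂F₁ a b c) x :=
  (hasFPowerSeriesOnBall_ordinaryHypergeometric h).analyticAt_of_mem (by
    simpa [← ofReal_norm] using hx)

theorem hasSum_ordinaryHypergeometric {a b c : ℂ} (h : GenericParams a b c) {x : ℂ}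
    (hx : ‖x‖ < 1) :
    HasSum (fun k => gaussCoeff a b c k * x ^ k) (₂F₁ a b c x) := by
  have := (hasFPowerSeriesOnBall_ordinaryHypergeometric h).hasSum (y := x) (by
    simpa [← ofReal_norm] using hx)
  simpa only [ordinaryHypergeometricSeries_apply_eq, smul_eq_mul, zero_add, gaussCoeff] using this

theorem hasSum_mul_deriv_ordinaryHypergeometric {a b c : ℂ} (h : GenericParams a b c) {x : ℂ}
    (hx : ‖x‖ < 1) :
    HasSum (fun k : ℕ => (k : ℂ) * gaussCoeff a b c k * x ^ k)
      (x * deriv (₂F₁ a b c) x) := by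
  have h1 := (hasFPowerSeriesOnBall_ordinaryHypergeometric h).fderiv.hasSum (y := x) (by
    simpa [← ofReal_norm] using hx)
  have h2 := h1.mapL (ContinuousLinearMap.apply ℂ ℂ x)
  simp only [ContinuousLinearMap.apply_apply, zero_add,
    FormalMultilinearSeries.derivSeries_apply_diag, ordinaryHypergeometricSeries_apply_eq] at h2
  rw [fderiv_eq_smul_deriv, smul_eq_mul] at h2
  rw [← hasSum_nat_add_iff' 1]
  simpa [mul_assoc, add_comm, gaussCoeff] using h2

/-- Coefficient comparison for a relation `A - x B = C` between sums of power series. -/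
theorem sub_mul_eq_of_hasSum {A B C : ℕ → ℂ} {x SA SB SC : ℂ}
    (hA : HasSum (fun k => A k * x ^ k) SA) (hB : HasSum (fun k => B k * x ^ k) SB)
    (hC : HasSum (fun k => C k * x ^ k) SC) (h0 : A 0 = C 0)
    (h1 : ∀ k, A (k + 1) - B k = C (k + 1)) : SA - x * SB = SC := by
  rw [← hasSum_nat_add_iff' 1] at hA hC
  have h2 := (hA.sub (hB.mul_left x)).sub hC
  have h3 : (fun k => A (k + 1) * x ^ (k + 1) - x * (B k * x ^ k) - C (k + 1) * x ^ (k + 1)) =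
      fun _ => 0 := by
    funext k
    rw [← h1 k]; ring
  rw [h3] at h2
  have h4 := h2.unique hasSum_zero
  simp only [Finset.sum_range_one, pow_zero, mul_one] at h4
  linear_combination h4 + h0

theorem gaussCoeff_succ {a b c : ℂ} (h : GenericParams a b c) (k : ℕ) :
    gaussCoeff a b c (k + 1) =
      (a + k) * (b + k) / ((c + k) * (k + 1)) * gaussCoeff a b c k := by
  have h1 := h.eval_ne_zero k
  have h2 := h.add_ne_zero k
  have h3 : (k : ℂ) + 1 ≠ 0 := Nat.cast_add_one_ne_zero k
  have h4 : (k.factorial : ℂ) ≠ 0 := Nat.cast_ne_zero.2 k.factorial_ne_zero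
  simp only [gaussCoeff, ascPochhammer_succ_eval, Nat.factorial_succ]
  push_cast
  field_simp

theorem ordinaryHypergeometric_raise_left {a b c : ℂ} (h : GenericParams a b c)
    (h' : GenericParams (a + 1) b c) {x : ℂ} (hx : ‖x‖ < 1) :
    x * deriv (₂F₁ a b c) x + a * ₂F₁ a b c x = a * ₂F₁ (a + 1) b c x := by
  have h1 := (hasSum_mul_deriv_ordinaryHypergeometric h hx).add
    ((hasSum_ordinaryHypergeometric h hx).mul_left a)
  have h2 := (hasSum_ordinaryHypergeometric h' hx).mul_left a
  refine h1.unique (h2.congr_fun ?_)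
  intro k
  have := mul_eval_add_one_ascPochhammer a k
  simp only [gaussCoeff]
  linear_combination (-(k.factorial : ℂ)⁻¹ * (ascPochhammer ℂ k).eval b *
    ((ascPochhammer ℂ k).eval c)⁻¹ * x ^ k) * this

/-- Three of the contiguity relations express `(ϑ + e) F - x (ϑ + a) F`, with `ϑ = x d/dx`, through
a contiguous function; this reduces them to an identity between coefficients. -/
theorem sub_mul_eq_of_coefficients {a b c e : ℂ} (h : GenericParams a b c) {x SC : ℂ} {C : ℕ → ℂ}
    (hx : ‖x‖ < 1) (hC : HasSum (fun k => C k * x ^ k) SC) (h0 : e = C 0)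
    (h1 : ∀ k : ℕ, ((k + 1 + e) * ((a + k) * (b + k) / ((c + k) * (k + 1))) - (a + k)) *
      gaussCoeff a b c k = C (k + 1)) :
    x * (1 - x) * deriv (₂F₁ a b c) x + (e - a * x) * ₂F₁ a b c x = SC := by
  have hF := hasSum_ordinaryHypergeometric h hx
  have hD := hasSum_mul_deriv_ordinaryHypergeometric h hx
  have hA := hD.add (hF.mul_left e)
  have hB := hD.add (hF.mul_left a)
  simp only [← mul_assoc, ← add_mul] at hA hB
  have := sub_mul_eq_of_hasSum hA hB hC (by simp [← h0, gaussCoeff_zero]) (fun k => by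
    rw [← h1 k, gaussCoeff_succ h]; push_cast; ring)
  linear_combination this

theorem ordinaryHypergeometric_lower_right {a b c : ℂ} (h : GenericParams a b c)
    (h' : GenericParams a (b - 1) c) {x : ℂ} (hx : ‖x‖ < 1) :
    x * (1 - x) * deriv (₂F₁ a b c) x + (c - b - a * x) * ₂F₁ a b c x =
      (c - b) * ₂F₁ a (b - 1) c x := by
  have hC := (hasSum_ordinaryHypergeometric h' hx).mul_left (c - b)
  simp only [← mul_assoc] at hC
  refine sub_mul_eq_of_coefficients h hx hC (by simp [gaussCoeff_zero]) fun k => ?_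
  have h2 := h.add_ne_zero k
  have h3 : (k : ℂ) + 1 ≠ 0 := Nat.cast_add_one_ne_zero k
  have h6 := h.eval_ne_zero k
  have h8 : (k.factorial : ℂ) ≠ 0 := Nat.cast_ne_zero.2 k.factorial_ne_zero
  simp only [gaussCoeff]
  rw [ascPochhammer_sub_one_succ_eval, ascPochhammer_succ_eval, ascPochhammer_succ_eval,
    Nat.factorial_succ]
  push_cast
  field_simp
  ring

theorem ordinaryHypergeometric_lower_right_bot {a b c : ℂ} (h : GenericParams a b c)
    (h' : GenericParams a (b - 1) (c - 1)) {x : ℂ} (hx : ‖x‖ < 1) :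
    x * (1 - x) * deriv (₂F₁ a b c) x + (c - 1 - a * x) * ₂F₁ a b c x =
      (c - 1) * ₂F₁ a (b - 1) (c - 1) x := by
  have hC := (hasSum_ordinaryHypergeometric h' hx).mul_left (c - 1)
  simp only [← mul_assoc] at hC
  refine sub_mul_eq_of_coefficients h hx hC (by simp [gaussCoeff_zero]) fun k => ?_
  have h2 := h.add_ne_zero k
  have h2' := h'.add_ne_zero 0
  rw [Nat.cast_zero, add_zero] at h2'
  have h3 : (k : ℂ) + 1 ≠ 0 := Nat.cast_add_one_ne_zero k
  have h6 := h.eval_ne_zero k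
  have h8 : (k.factorial : ℂ) ≠ 0 := Nat.cast_ne_zero.2 k.factorial_ne_zero
  simp only [gaussCoeff]
  rw [ascPochhammer_sub_one_succ_eval, ascPochhammer_sub_one_succ_eval, ascPochhammer_succ_eval,
    Nat.factorial_succ]
  push_cast
  field_simp
  ring

theorem ordinaryHypergeometric_raise_left_bot {a b c : ℂ} (h : GenericParams a b c)
    (h' : GenericParams (a + 1) b (c + 1)) {x : ℂ} (hx : ‖x‖ < 1) :
    x * (1 - x) * deriv (₂F₁ a b c) x - a * x * ₂F₁ a b c x =
      - (a * (c - b) / c) * x * ₂F₁ (a + 1) b (c + 1) x := by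
  have hC := (hasSum_ordinaryHypergeometric h' hx).mul_left (- (a * (c - b) / c) * x)
  have hC' : HasSum (fun k => (if k = 0 then 0 else - (a * (c - b) / c) *
    gaussCoeff (a + 1) b (c + 1) (k - 1)) * x ^ k)
    (- (a * (c - b) / c) * x * ₂F₁ (a + 1) b (c + 1) x) := by
    rw [← hasSum_nat_add_iff' 1]
    simpa [pow_succ', mul_assoc, mul_left_comm] using hC
  have := sub_mul_eq_of_coefficients (e := 0) h hx hC' (by simp) fun k => ?_
  · rw [← this]; ring
  have h2 := h.add_ne_zero k
  have h2' := h.add_ne_zero 0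
  have h3 : (k : ℂ) + 1 ≠ 0 := Nat.cast_add_one_ne_zero k
  have h4 := mul_eval_add_one_ascPochhammer a k
  have h5 := mul_eval_add_one_ascPochhammer c k
  have h6 := h.eval_ne_zero k
  rw [Nat.cast_zero, add_zero] at h2'
  rw [if_neg k.succ_ne_zero, Nat.add_sub_cancel]
  have h8 : (k.factorial : ℂ) ≠ 0 := Nat.cast_ne_zero.2 k.factorial_ne_zero
  have h9 : (ascPochhammer ℂ k).eval (c + 1) =
      (c + k) * (ascPochhammer ℂ k).eval c / c := by rw [← h5]; field_simp
  simp only [gaussCoeff, h9]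
  field_simp
  linear_combination (c - b) * (k + 1) * (ascPochhammer ℂ k).eval b * h4

/-! ### Pulling the contiguity relations back along the octahedral map -/

/-- The polynomial function `p_f(u) = 1 + 14 u + u ^ 2`; it satisfies
`1 - R = p_f ^ 3 / p_e ^ 2`. -/
noncomputable def octPf (u : ℂ) : ℂ := 1 + 14 * u + u ^ 2

/-- The hypergeometric function whose first two parameters differ by `1 / 2`. -/
noncomputable def halfF (β c x : ℂ) : ℂ := ₂F₁ (β / 2) (β / 2 + 1 / 2) c x

/-- None of `β`, `c` and `2 c - β` is an integer. This is stable under integer shifts of `β`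
and `c`, and it makes all constants in the contiguity relations of `halfF β c` nonzero. -/
structure NonResonant (β c : ℂ) : Prop where
  beta_ne : ∀ k : ℤ, β ≠ k
  bot_ne : ∀ k : ℤ, c ≠ k
  diff_ne : ∀ k : ℤ, 2 * c - β ≠ k

namespace NonResonant

variable {β c : ℂ}

theorem shift (h : NonResonant β c) {β' c' : ℂ} (i j : ℤ) (hi : β' = β + i) (hj : c' = c + j) :
    NonResonant β' c' where
  beta_ne k hk := h.beta_ne (k - i) (by push_cast; linear_combination hk - hi)
  bot_ne k hk := h.bot_ne (k - j) (by push_cast; linear_combination hk - hj)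
  diff_ne k hk := h.diff_ne (k - 2 * j + i) (by
    push_cast; linear_combination hk - 2 * hj + hi)

theorem generic (h : NonResonant β c) : GenericParams (β / 2) (β / 2 + 1 / 2) c := fun k =>
  ⟨fun hk => h.beta_ne (-2 * k) (by push_cast; linear_combination 2 * hk),
    fun hk => h.beta_ne (-2 * k - 1) (by push_cast; linear_combination 2 * hk),
    fun hk => h.bot_ne (-k) (by push_cast; linear_combination hk)⟩

theorem ne_zero (h : NonResonant β c) : β ≠ 0 := by simpa using h.beta_ne 0

theorem bot_ne_zero (h : NonResonant β c) : c ≠ 0 := by simpa using h.bot_ne 0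

theorem bot_sub_one_ne_zero (h : NonResonant β c) : c - 1 ≠ 0 := fun h0 =>
  h.bot_ne 1 (by push_cast; linear_combination h0)

theorem bot_sub_ne_zero (h : NonResonant β c) : c - (β / 2 + 1 / 2) ≠ 0 := fun h0 =>
  h.diff_ne 1 (by push_cast; linear_combination 2 * h0)

end NonResonant

/-- Raising `β` by one interchanges the two upper parameters and raises one of them. -/
theorem halfF_eq_raised (β c x : ℂ) : halfF (β + 1) c x = ₂F₁ (β / 2 + 1) (β / 2 + 1 / 2) c x := by
  unfold halfF ordinaryHypergeometric
  rw [ordinaryHypergeometricSeries_symm]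
  congr 2 <;> ring

theorem halfF_eq_lowered (β c x : ℂ) :
    halfF (β - 1) c x = ₂F₁ (β / 2) (β / 2 + 1 / 2 - 1) c x := by
  unfold halfF ordinaryHypergeometric
  rw [ordinaryHypergeometricSeries_symm]
  congr 2 <;> ring

theorem GenericParams.symm {a b c : ℂ} (h : GenericParams a b c) : GenericParams b a c :=
  fun k => ⟨(h k).2.1, (h k).1, (h k).2.2⟩

theorem octPe_zero : octPe 0 = 1 := by simp [octPe]

theorem octMap_zero : octMap 0 = 0 := by simp [octMap, octPv]

theorem hasDerivAt_octPe (u : ℂ) : HasDerivAt octPe (-33 - 66 * u + 3 * u ^ 2) u := by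
  have h1 := (hasDerivAt_id u).const_add 1
  have h2 := (((hasDerivAt_id u).const_mul 34).const_sub 1).add ((hasDerivAt_id u).pow 2)
  refine ((h1.mul h2).congr_deriv ?_)
  simp
  ring

theorem continuous_octPe : Continuous octPe := by unfold octPe; fun_prop

theorem hasDerivAt_octMap {u : ℂ} (hu : octPe u ≠ 0) :
    HasDerivAt octMap (-108 * (1 - u) ^ 3 * octPf u ^ 2 / octPe u ^ 3) u := by
  have h1 : HasDerivAt octPv ((1 - u) ^ 3 * (1 - 5 * u)) u := by
    refine ((hasDerivAt_id u).mul (((hasDerivAt_id u).const_sub 1).pow 4)).congr_deriv ?_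
    simp
    ring
  refine ((h1.const_mul (-108)).div ((hasDerivAt_octPe u).pow 2) (pow_ne_zero 2 hu)).congr_deriv ?_
  simp only [Pi.pow_apply, Nat.cast_ofNat, Nat.reduceSub, pow_one]
  rw [div_eq_div_iff (by positivity) (by positivity)]
  unfold octPe octPf octPv
  ring

/-- The points close to `0` at which all ingredients of the pulled back relations are regular. -/
structure RegularPoint (u : ℂ) : Prop where
  ne_one : 1 - u ≠ 0
  slit : octPe u ∈ Complex.slitPlane
  norm_lt : ‖octMap u‖ < 1
  pf_ne : octPf u ≠ 0

namespace RegularPoint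

variable {u : ℂ}

theorem pe_ne (h : RegularPoint u) : octPe u ≠ 0 := Complex.slitPlane_ne_zero h.slit

theorem one_sub_octMap (h : RegularPoint u) : 1 - octMap u = octPf u ^ 3 / octPe u ^ 2 := by
  have := h.pe_ne
  rw [octMap]
  field_simp
  unfold octPe octPf octPv
  ring

end RegularPoint

theorem continuousAt_octMap_zero : ContinuousAt octMap 0 :=
  (hasDerivAt_octMap (by simp [octPe_zero])).continuousAt

theorem eventually_regularPoint : ∀ᶠ u in 𝓝 (0 : ℂ), RegularPoint u := by
  have h1 : ∀ᶠ u in 𝓝 (0 : ℂ), (1 : ℂ) - u ≠ 0 :=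
    (by fun_prop : Continuous fun u : ℂ => 1 - u).continuousAt.eventually_ne (by simp)
  have h2 : ∀ᶠ u in 𝓝 (0 : ℂ), octPe u ∈ Complex.slitPlane :=
    continuous_octPe.continuousAt.eventually_mem
      (Complex.isOpen_slitPlane.mem_nhds (by simp [octPe_zero]))
  have h3 : ∀ᶠ u in 𝓝 (0 : ℂ), ‖octMap u‖ < 1 :=
    continuousAt_octMap_zero.norm.eventually_lt continuousAt_const (by simp [octMap_zero])
  have h4 : ∀ᶠ u in 𝓝 (0 : ℂ), octPf u ≠ 0 :=
    (by unfold octPf; fun_prop : Continuous octPf).continuousAt.eventually_ne (by simp [octPf])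
  filter_upwards [h1, h2, h3, h4] with u a b c d using ⟨a, b, c, d⟩

/-- `f` is, near `0`, the function `p_e ^ (-β) · (halfF β c ∘ R)`. The point `0` itself is left
out, so that values of rational functions can be computed away from finitely many points. -/
def IsPullback (β c : ℂ) (f : ℂ → ℂ) : Prop :=
  ∀ᶠ u in 𝓝[≠] (0 : ℂ), halfF β c (octMap u) = octPe u ^ β * f u

/-- The logarithmic derivative `ϑ F = x F'` in terms of the pullback. -/
theorem IsPullback.mul_deriv {β c : ℂ} {f : ℂ → ℂ} (hf : IsPullback β c f)
    (h : NonResonant β c) (hd : ∀ᶠ u in 𝓝[≠] (0 : ℂ), DifferentiableAt ℂ f u) :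
    ∀ᶠ u in 𝓝[≠] (0 : ℂ),
      octMap u * deriv (₂F₁ (β / 2) (β / 2 + 1 / 2) c) (octMap u) * octPf u ^ 2 =
        octPe u ^ β * (u * (1 - u)) *
          (octPe u * deriv f u + β * (-33 - 66 * u + 3 * u ^ 2) * f u) := by
  have hf' := eventually_eventually_nhdsWithin.2 hf
  filter_upwards [hf', hd, self_mem_nhdsWithin, nhdsWithin_le_nhds eventually_regularPoint]
    with u h1 h2 hu0 hu
  rw [isOpen_compl_singleton.nhdsWithin_eq hu0] at h1
  have hpe := hu.pe_ne
  have e1 : HasDerivAt (fun u => halfF β c (octMap u)) _ u :=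
    (analyticAt_ordinaryHypergeometric h.generic hu.norm_lt).differentiableAt.hasDerivAt.comp u
      (hasDerivAt_octMap hpe)
  have e2 := ((hasDerivAt_octPe u).cpow_const (c := β) hu.slit).mul h2.hasDerivAt
  have e3 := e1.unique (e2.congr_of_eventuallyEq h1)
  rw [Complex.cpow_sub _ _ hpe, Complex.cpow_one] at e3
  have e4 : octMap u * octPf u ^ 2 =
      u * (1 - u) * octPe u * (-108 * (1 - u) ^ 3 * octPf u ^ 2 / octPe u ^ 3) := by
    unfold octMap octPv
    field_simp
  rw [mul_right_comm, e4, mul_assoc, mul_comm (_ / _), e3]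
  field_simp
  ring

section Moves

variable {β c : ℂ} {f : ℂ → ℂ}

/-- The effect of `β ↦ β + 1` on the pullback. -/
noncomputable def raiseBeta (β : ℂ) (u y y' : ℂ) : ℂ :=
  (u * (1 - u) * y' + β / 2 * (1 - 5 * u) * y) / (β / 2 * octPf u ^ 2)

/-- The effect of `β ↦ β - 1` on the pullback for `e = c - (β + 1) / 2`, and of
`(β, c) ↦ (β - 1, c - 1)` for `e = c - 1`. -/
noncomputable def lowerBeta (β e : ℂ) (u y y' : ℂ) : ℂ :=
  (u * (1 - u) * octPf u * y' + (e * octPe u + β * (u * (1 - u) * (3 * u + 21))) * y) / e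

/-- The effect of `(β, c) ↦ (β + 1, c + 1)` on the pullback. -/
noncomputable def raiseBoth (β c : ℂ) (u y y' : ℂ) : ℂ :=
  (octPf u * y' + β * (3 * u + 21) * y) /
    (108 * (β / 2 * (c - (β / 2 + 1 / 2)) / c) * (1 - u) ^ 3)

theorem IsPullback.raiseBeta (hf : IsPullback β c f) (h : NonResonant β c)
    (hd : ∀ᶠ u in 𝓝[≠] (0 : ℂ), DifferentiableAt ℂ f u) :
    IsPullback (β + 1) c fun u => raiseBeta β u (f u) (deriv f u) := by
  have hg : GenericParams (β / 2 + 1) (β / 2 + 1 / 2) c := by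
    convert (h.shift (c' := c) 1 0 rfl (by simp)).generic.symm using 1 <;> push_cast <;> ring
  have hm := hf.mul_deriv h hd
  unfold IsPullback at *
  filter_upwards [hf, hm, nhdsWithin_le_nhds eventually_regularPoint]
    with u h1 h2 hu
  have hpe := hu.pe_ne
  have hpf := hu.pf_ne
  have hβ := h.ne_zero
  have h3 := ordinaryHypergeometric_raise_left h.generic hg hu.norm_lt
  rw [halfF] at h1
  rw [← halfF_eq_raised, h1] at h3
  rw [Complex.cpow_add _ _ hpe, Complex.cpow_one, _root_.raiseBeta]
  field_simp
  -- Both sides are `u (1 - u) p_e R' / R`.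
  have h4 : octPf u ^ 2 =
      (1 - 5 * u) * octPe u - 2 * (u * (1 - u) * (-33 - 66 * u + 3 * u ^ 2)) := by
    unfold octPf octPe; ring
  linear_combination (-2 * octPf u ^ 2) * h3 + 2 * h2 + β * octPe u ^ β * f u * h4

/-- The operator `(ϑ + e) - x (ϑ + a)` in terms of the pullback. The factor `p_e` that the derivative
of `p_e ^ β` puts in the denominator cancels, because `p_f p_e' + 54 (1 - u) ^ 3` is divisible by
`p_e`. -/
theorem IsPullback.lowerBeta_aux (hf : IsPullback β c f) (h : NonResonant β c)
    (hd : ∀ᶠ u in 𝓝[≠] (0 : ℂ), DifferentiableAt ℂ f u) (e : ℂ) :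
    ∀ᶠ u in 𝓝[≠] (0 : ℂ),
      octMap u * (1 - octMap u) * deriv (₂F₁ (β / 2) (β / 2 + 1 / 2) c) (octMap u) +
        (e - β / 2 * octMap u) * ₂F₁ (β / 2) (β / 2 + 1 / 2) c (octMap u) =
      octPe u ^ β / octPe u * (u * (1 - u) * octPf u * deriv f u +
        (e * octPe u + β * (u * (1 - u) * (3 * u + 21))) * f u) := by
  have hm := hf.mul_deriv h hd
  unfold IsPullback at hf
  filter_upwards [hf, hm, nhdsWithin_le_nhds eventually_regularPoint]
    with u h1 h2 hu
  have hpe := hu.pe_ne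
  have hpf := hu.pf_ne
  rw [halfF] at h1
  have h3 : octMap u * deriv (₂F₁ (β / 2) (β / 2 + 1 / 2) c) (octMap u) =
    octPe u ^ β * (u * (1 - u)) *
          (octPe u * deriv f u + β * (-33 - 66 * u + 3 * u ^ 2) * f u) / octPf u ^ 2 := by
    rw [← h2]; field_simp
  have h4 : octPf u * (-33 - 66 * u + 3 * u ^ 2) + 54 * (1 - u) ^ 3 = octPe u * (3 * u + 21) := by
    unfold octPf octPe; ring
  rw [mul_right_comm, h3, h1, hu.one_sub_octMap, octMap, octPv]
  field_simp
  linear_combination (2 * octPe u ^ β * β * f u * u * (1 - u)) * h4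

theorem IsPullback.lowerBeta (hf : IsPullback β c f) (h : NonResonant β c)
    (hd : ∀ᶠ u in 𝓝[≠] (0 : ℂ), DifferentiableAt ℂ f u) :
    IsPullback (β - 1) c
      fun u => lowerBeta β (c - (β / 2 + 1 / 2)) u (f u) (deriv f u) := by
  have hg : GenericParams (β / 2) (β / 2 + 1 / 2 - 1) c := by
    convert (h.shift (c' := c) (-1) 0 rfl (by simp)).generic.symm using 1 <;> push_cast <;> ring
  have haux := hf.lowerBeta_aux h hd (c - (β / 2 + 1 / 2))
  unfold IsPullback at *
  filter_upwards [haux, nhdsWithin_le_nhds eventually_regularPoint] with u h1 hu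
  have hpe := hu.pe_ne
  have he := h.bot_sub_ne_zero
  rw [ordinaryHypergeometric_lower_right h.generic hg hu.norm_lt, ← halfF_eq_lowered] at h1
  rw [Complex.cpow_sub _ _ hpe, Complex.cpow_one, _root_.lowerBeta, ← mul_div_assoc, ← h1]
  rw [mul_div_cancel_left₀ _ he]

/-- The step `(β, c) ↦ (β - 1, c - 1)`. -/
theorem IsPullback.lowerBoth (hf : IsPullback β c f) (h : NonResonant β c)
    (hd : ∀ᶠ u in 𝓝[≠] (0 : ℂ), DifferentiableAt ℂ f u) :
    IsPullback (β - 1) (c - 1) fun u => _root_.lowerBeta β (c - 1) u (f u) (deriv f u) := by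
  have hg : GenericParams (β / 2) (β / 2 + 1 / 2 - 1) (c - 1) := by
    convert (h.shift (-1) (-1) rfl rfl).generic.symm using 1 <;> push_cast <;> ring
  have haux := hf.lowerBeta_aux h hd (c - 1)
  unfold IsPullback at *
  filter_upwards [haux, nhdsWithin_le_nhds eventually_regularPoint] with u h1 hu
  have hpe := hu.pe_ne
  have he := h.bot_sub_one_ne_zero
  rw [ordinaryHypergeometric_lower_right_bot h.generic hg hu.norm_lt, ← halfF_eq_lowered] at h1
  rw [Complex.cpow_sub _ _ hpe, Complex.cpow_one, _root_.lowerBeta, ← mul_div_assoc, ← h1]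
  rw [mul_div_cancel_left₀ _ he]

theorem IsPullback.raiseBoth (hf : IsPullback β c f) (h : NonResonant β c)
    (hd : ∀ᶠ u in 𝓝[≠] (0 : ℂ), DifferentiableAt ℂ f u) :
    IsPullback (β + 1) (c + 1) fun u => raiseBoth β c u (f u) (deriv f u) := by
  have hg : GenericParams (β / 2 + 1) (β / 2 + 1 / 2) (c + 1) := by
    convert (h.shift 1 1 rfl rfl).generic.symm using 1 <;> push_cast <;> ring
  have haux := hf.lowerBeta_aux h hd 0
  unfold IsPullback at *
  filter_upwards [haux, self_mem_nhdsWithin, nhdsWithin_le_nhds eventually_regularPoint]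
    with u h1 hu0 hu
  have hu0 : u ≠ 0 := hu0
  have hpe := hu.pe_ne
  have hu1 := hu.ne_one
  have hβ := h.ne_zero
  have hc := h.bot_ne_zero
  have he := h.bot_sub_ne_zero
  have h2 := ordinaryHypergeometric_raise_left_bot h.generic hg hu.norm_lt
  rw [← halfF_eq_raised] at h2
  have h3 : octMap u = -108 * (u * (1 - u) ^ 4) / octPe u ^ 2 := rfl
  set κ := β / 2 * (c - (β / 2 + 1 / 2)) / c with hκ
  have hκ0 : κ ≠ 0 := div_ne_zero (mul_ne_zero (div_ne_zero hβ two_ne_zero) he) hc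
  have h4 : -κ * octMap u * halfF (β + 1) (c + 1) (octMap u) =
      octPe u ^ β / octPe u * (u * (1 - u) * (octPf u * deriv f u + β * (3 * u + 21) * f u)) := by
    rw [← h2]
    linear_combination h1
  have h5 : -κ * octMap u ≠ 0 := by
    rw [h3]
    exact mul_ne_zero (neg_ne_zero.2 hκ0) (div_ne_zero (mul_ne_zero (by norm_num)
      (mul_ne_zero hu0 (pow_ne_zero 4 hu1))) (pow_ne_zero 2 hpe))
  apply mul_left_cancel₀ h5
  rw [h4, Complex.cpow_add _ _ hpe, Complex.cpow_one, _root_.raiseBoth, ← hκ, h3]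
  field_simp

end Moves

/-! ### The two algebraic Gauss functions for `n = m = 0` -/

theorem octPe_cpow_mul_cpow_neg {u : ℂ} (hu : octPe u ≠ 0) (β : ℂ) :
    octPe u ^ β * octPe u ^ (-β) = 1 := by
  rw [← Complex.cpow_add _ _ hu, add_neg_cancel, Complex.cpow_zero]

/-- The pullback of `halfF β c` itself, as a function analytic at `0`. -/
noncomputable def gaussPullback (β c u : ℂ) : ℂ := octPe u ^ (-β) * halfF β c (octMap u)

theorem isPullback_gaussPullback (β c : ℂ) : IsPullback β c (gaussPullback β c) := by
  filter_upwards [nhdsWithin_le_nhds eventually_regularPoint] with u hu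
  rw [gaussPullback, ← mul_assoc, octPe_cpow_mul_cpow_neg hu.pe_ne, one_mul]

theorem gaussPullback_zero (β c : ℂ) : gaussPullback β c 0 = 1 := by
  simp [gaussPullback, octPe_zero, octMap_zero, halfF]

theorem analyticAt_gaussPullback {β c : ℂ} (h : NonResonant β c) :
    AnalyticAt ℂ (gaussPullback β c) 0 := by
  have hpe : AnalyticAt ℂ octPe 0 := by unfold octPe; fun_prop
  have hpv : AnalyticAt ℂ octPv 0 := by unfold octPv; fun_prop
  have hmap : AnalyticAt ℂ octMap 0 :=
    (analyticAt_const.mul hpv).div (hpe.pow 2) (by simp [octPe_zero])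
  have hF : AnalyticAt ℂ (halfF β c) (octMap 0) :=
    analyticAt_ordinaryHypergeometric h.generic (by simp [octMap_zero])
  exact (hpe.cpow analyticAt_const (by simp [octPe_zero])).mul (hF.comp hmap)

/-- The hypergeometric differential equation for a pullback, obtained by raising `β` and lowering
it again. -/
theorem IsPullback.ode {β c : ℂ} {f : ℂ → ℂ} (hf : IsPullback β c f) (h : NonResonant β c)
    (ha : AnalyticAt ℂ f 0) :
    ∀ᶠ u in 𝓝[≠] (0 : ℂ),
      (c - (β / 2 + 1)) * (β / 2) * octPf u ^ 2 * f u =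
        u * (1 - u) * (octPf u * ((1 - 2 * u) * deriv f u + u * (1 - u) * deriv (deriv f) u +
          β / 2 * ((1 - 5 * u) * deriv f u - 5 * f u)) -
          2 * (14 + 2 * u) * (u * (1 - u) * deriv f u + β / 2 * (1 - 5 * u) * f u)) +
        ((c - (β / 2 + 1)) * octPe u + (β + 1) * (u * (1 - u) * (3 * u + 21))) *
          (u * (1 - u) * deriv f u + β / 2 * (1 - 5 * u) * f u) := by
  have hβ := h.ne_zero
  have ha' : ∀ᶠ u in 𝓝[≠] (0 : ℂ), AnalyticAt ℂ f u :=
    nhdsWithin_le_nhds ha.eventually_analyticAt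
  have hreg : ∀ᶠ u in 𝓝[≠] (0 : ℂ), RegularPoint u := nhdsWithin_le_nhds eventually_regularPoint
  have h1 := hf.raiseBeta h (ha'.mono fun u hu => hu.differentiableAt)
  have hD : ∀ᶠ u in 𝓝[≠] (0 : ℂ),
      HasDerivAt (fun u => _root_.raiseBeta β u (f u) (deriv f u))
        ((octPf u * ((1 - 2 * u) * deriv f u + u * (1 - u) * deriv (deriv f) u +
          β / 2 * ((1 - 5 * u) * deriv f u - 5 * f u)) -
          2 * (14 + 2 * u) * (u * (1 - u) * deriv f u + β / 2 * (1 - 5 * u) * f u)) /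
          (β / 2 * octPf u ^ 3)) u := by
    filter_upwards [ha', hreg] with u hu hr
    have hpf := hr.pf_ne
    have e1 : HasDerivAt (fun u : ℂ => u * (1 - u)) (1 - 2 * u) u :=
      ((hasDerivAt_id u).mul ((hasDerivAt_id u).const_sub 1)).congr_deriv (by simp; ring)
    have e2 : HasDerivAt (fun u : ℂ => β / 2 * (1 - 5 * u)) (β / 2 * -5) u :=
      ((((hasDerivAt_id u).const_mul 5).const_sub 1).const_mul (β / 2)).congr_deriv (by simp)
    have e3 : HasDerivAt octPf (14 + 2 * u) u :=
      ((((hasDerivAt_id u).const_mul 14).const_add 1).add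
        ((hasDerivAt_id u).pow 2)).congr_deriv (by simp)
    have e4 := ((e1.mul hu.deriv.differentiableAt.hasDerivAt).add
      (e2.mul hu.differentiableAt.hasDerivAt)).div ((e3.pow 2).const_mul (β / 2))
      (by exact mul_ne_zero (div_ne_zero hβ two_ne_zero) (pow_ne_zero 2 hpf))
    refine e4.congr_deriv ?_
    simp
    field_simp
    ring
  have h2 := h1.lowerBeta (h.shift 1 0 (by simp) (by simp)) (hD.mono fun u hu => hu.differentiableAt)
  rw [add_sub_cancel_right] at h2
  unfold IsPullback at hf h2
  filter_upwards [hf, h2, hD, hreg] with u a1 a2 a3 hr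
  have hpe := hr.pe_ne
  have hpf := hr.pf_ne
  have he : c - ((β + 1) / 2 + 1 / 2) ≠ 0 :=
    (h.shift (c' := c) 1 0 (β' := β + 1) (by simp) (by simp)).bot_sub_ne_zero
  have hP : octPe u ^ β ≠ 0 := by simp [Complex.cpow_eq_zero_iff, hpe]
  rw [a1, a3.deriv] at a2
  have a4 := mul_left_cancel₀ hP a2
  rw [_root_.lowerBeta, eq_div_iff he, _root_.raiseBeta] at a4
  field_simp at a4
  linear_combination (1 / 4) * a4

/-- A function analytic at `0` with `u W' = -κ W` vanishes near `0` unless `-κ` is one of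
`0, 1, 2, …`: the equation forces the leading exponent of `W` to be `-κ`. -/
theorem eventually_eq_zero_of_euler {W : ℂ → ℂ} (hW : AnalyticAt ℂ W 0) {κ : ℂ}
    (hκ : ∀ k : ℕ, (k : ℂ) + κ ≠ 0) (h : ∀ᶠ u in 𝓝[≠] (0 : ℂ), u * deriv W u + κ * W u = 0) :
    ∀ᶠ u in 𝓝 (0 : ℂ), W u = 0 := by
  by_contra hne
  obtain ⟨k, V, hV, hV0, hWV⟩ := hW.exists_eventuallyEq_pow_smul_nonzero_iff.2 hne
  simp only [sub_zero, smul_eq_mul] at hWV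
  have h1 : ∀ᶠ u in 𝓝[≠] (0 : ℂ), (k + κ) * V u + u * deriv V u = 0 := by
    filter_upwards [h, nhdsWithin_le_nhds hWV.eventually_nhds, self_mem_nhdsWithin,
      nhdsWithin_le_nhds hV.eventually_analyticAt] with u hu hu' hu0 hVu
    have hu0 : u ≠ 0 := hu0
    have hd : HasDerivAt W _ u :=
      (((hasDerivAt_id u).pow k).mul hVu.differentiableAt.hasDerivAt).congr_of_eventuallyEq hu'
    have hk : (k : ℂ) * u ^ (k - 1) * u = k * u ^ k := by
      rcases k with _ | k
      · simp
      · rw [Nat.add_sub_cancel, pow_succ, mul_assoc]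
    rw [hd.deriv, hu'.self_of_nhds] at hu
    simp only [id, mul_one, Pi.pow_apply] at hu
    apply mul_left_cancel₀ (pow_ne_zero k hu0)
    linear_combination hu - V u * hk
  have h2 : Tendsto (fun u => (k + κ) * V u + u * deriv V u) (𝓝[≠] 0)
      (𝓝 ((k + κ) * V 0 + 0 * deriv V 0)) :=
    ((hV.continuousAt.const_mul _).add
      (continuousAt_id.mul hV.deriv.continuousAt)).tendsto.mono_left nhdsWithin_le_nhds
  have h3 := tendsto_nhds_unique (h2.congr' h1) tendsto_const_nhds
  rw [zero_mul, add_zero] at h3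
  exact mul_ne_zero (hκ k) hV0 h3

theorem eventually_const_of_euler_deriv {g : ℂ → ℂ} (hg : AnalyticAt ℂ g 0) {κ : ℂ}
    (hκ : ∀ k : ℕ, (k : ℂ) + κ ≠ 0)
    (h : ∀ᶠ u in 𝓝[≠] (0 : ℂ), u * deriv (deriv g) u + κ * deriv g u = 0) :
    ∀ᶠ u in 𝓝 (0 : ℂ), g u = g 0 := by
  have h1 := (eventually_eq_zero_of_euler hg.deriv hκ h).and
    (hg.eventually_analyticAt.mono fun u hu => hu.differentiableAt)
  obtain ⟨ε, hε, hball⟩ := Metric.eventually_nhds_iff_ball.1 h1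
  filter_upwards [Metric.ball_mem_nhds (0 : ℂ) hε] with u hu
  exact Metric.isOpen_ball.is_const_of_deriv_eq_zero
    (convex_ball (0 : ℂ) ε).isPreconnected
    (fun x hx => (hball x hx).2.differentiableWithinAt) (fun x hx => (hball x hx).1) hu
    (Metric.mem_ball_self hε)

theorem nonResonant_base : NonResonant (-1 / 12) (3 / 4) where
  beta_ne k hk := by
    have : (-1 : ℂ) = ((12 * k : ℤ) : ℂ) := by push_cast; linear_combination 12 * hk
    have := (by exact_mod_cast this : (-1 : ℤ) = 12 * k)
    omega
  bot_ne k hk := by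
    have : (3 : ℂ) = ((4 * k : ℤ) : ℂ) := by push_cast; linear_combination 4 * hk
    have := (by exact_mod_cast this : (3 : ℤ) = 4 * k)
    omega
  diff_ne k hk := by
    have : (19 : ℂ) = ((12 * k : ℤ) : ℂ) := by push_cast; linear_combination 12 * hk
    have := (by exact_mod_cast this : (19 : ℤ) = 12 * k)
    omega

theorem nonResonant_base_conj : NonResonant (5 / 12) (5 / 4) where
  beta_ne k hk := by
    have : (5 : ℂ) = ((12 * k : ℤ) : ℂ) := by push_cast; linear_combination 12 * hk
    have := (by exact_mod_cast this : (5 : ℤ) = 12 * k)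
    omega
  bot_ne k hk := by
    have : (5 : ℂ) = ((4 * k : ℤ) : ℂ) := by push_cast; linear_combination 4 * hk
    have := (by exact_mod_cast this : (5 : ℤ) = 4 * k)
    omega
  diff_ne k hk := by
    have : (25 : ℂ) = ((12 * k : ℤ) : ℂ) := by push_cast; linear_combination 12 * hk
    have := (by exact_mod_cast this : (25 : ℤ) = 12 * k)
    omega

theorem natCast_add_ne_zero_of_re_pos {κ : ℝ} (hκ : 0 < κ) (k : ℕ) : (k : ℂ) + (κ : ℂ) ≠ 0 := by
  have : (k : ℝ) + κ ≠ 0 := by positivity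
  exact_mod_cast this

theorem isPullback_base : IsPullback (-1 / 12) (3 / 4) fun _ => 1 := by
  set f := gaussPullback (-1 / 12) (3 / 4) with hf
  have ha : AnalyticAt ℂ f 0 := analyticAt_gaussPullback nonResonant_base
  have h1 := isPullback_gaussPullback (-1 / 12) (3 / 4)
  have h2 := h1.ode nonResonant_base ha
  rw [← hf] at h1 h2
  have h3 : ∀ᶠ u in 𝓝 (0 : ℂ), f u = f 0 := by
    refine eventually_const_of_euler_deriv ha (κ := ((3 / 4 : ℝ) : ℂ))
      (natCast_add_ne_zero_of_re_pos (by norm_num)) ?_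
    filter_upwards [h2, self_mem_nhdsWithin, nhdsWithin_le_nhds eventually_regularPoint]
      with u hu hu0 hr
    have hu0 : u ≠ 0 := hu0
    apply mul_left_cancel₀ (mul_ne_zero (mul_ne_zero hu0 (pow_ne_zero 2 hr.ne_one)) hr.pf_ne)
    push_cast
    unfold octPf octPe at *
    linear_combination -hu
  unfold IsPullback at *
  filter_upwards [h1, nhdsWithin_le_nhds h3] with u a b
  rw [a, b, hf, gaussPullback_zero]

theorem isPullback_base_conj : IsPullback (5 / 12) (5 / 4) fun u => (1 - u)⁻¹ := by
  set f := gaussPullback (5 / 12) (5 / 4) with hf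
  have ha : AnalyticAt ℂ f 0 := analyticAt_gaussPullback nonResonant_base_conj
  have h1 := isPullback_gaussPullback (5 / 12) (5 / 4)
  have h2 := h1.ode nonResonant_base_conj ha
  rw [← hf] at h1 h2
  have hd : ∀ᶠ u in 𝓝 (0 : ℂ),
      deriv (fun u => (1 - u) * f u) u = (1 - u) * deriv f u - f u := by
    filter_upwards [ha.eventually_analyticAt] with u hu
    refine ((((hasDerivAt_id u).const_sub 1).mul hu.differentiableAt.hasDerivAt).congr_deriv
      ?_).deriv
    simp
    ring
  have hd2 : ∀ᶠ u in 𝓝 (0 : ℂ), deriv (deriv fun u => (1 - u) * f u) u =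
      (1 - u) * deriv (deriv f) u - 2 * deriv f u := by
    filter_upwards [hd.eventually_nhds, ha.eventually_analyticAt] with u hu hu'
    rw [EventuallyEq.deriv_eq hu]
    refine (((((hasDerivAt_id u).const_sub 1).mul hu'.deriv.differentiableAt.hasDerivAt).sub
      hu'.differentiableAt.hasDerivAt).congr_deriv ?_).deriv
    simp
    ring
  have h3 : ∀ᶠ u in 𝓝 (0 : ℂ), (1 - u) * f u = (1 - 0) * f 0 := by
    refine eventually_const_of_euler_deriv (g := fun u => (1 - u) * f u) (by fun_prop)
      (κ := ((5 / 4 : ℝ) : ℂ)) (natCast_add_ne_zero_of_re_pos (by norm_num)) ?_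
    filter_upwards [h2, self_mem_nhdsWithin, nhdsWithin_le_nhds eventually_regularPoint,
      nhdsWithin_le_nhds hd, nhdsWithin_le_nhds hd2] with u hu hu0 hr e1 e2
    have hu0 : u ≠ 0 := hu0
    rw [e1, e2]
    apply mul_left_cancel₀ (mul_ne_zero (mul_ne_zero hu0 hr.ne_one) hr.pf_ne)
    push_cast
    unfold octPf octPe at *
    linear_combination -hu
  unfold IsPullback at *
  filter_upwards [h1, nhdsWithin_le_nhds h3, nhdsWithin_le_nhds eventually_regularPoint]
    with u a b hr
  have h0 : f 0 = 1 := gaussPullback_zero _ _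
  rw [h0, sub_zero, one_mul] at b
  rw [a, eq_inv_of_mul_eq_one_right b]

/-! ### Values of rational functions away from finitely many points -/

section RatValue

theorem ratValue_eq_div (r : RatFunc ℂ) (u : ℂ) :
    ratValue r u = r.num.eval u / r.denom.eval u := rfl

theorem eventually_cofinite_eval_ne_zero {p : Polynomial ℂ} (hp : p ≠ 0) :
    ∀ᶠ u in cofinite, p.eval u ≠ 0 := by
  rw [eventually_cofinite]
  simpa [Polynomial.IsRoot] using Polynomial.finite_setOfPred_isRoot hp

theorem eventually_denom_ne_zero (r : RatFunc ℂ) : ∀ᶠ u in cofinite, r.denom.eval u ≠ 0 :=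
  eventually_cofinite_eval_ne_zero r.denom_ne_zero

@[simp]
theorem ratValue_algebraMap (p : Polynomial ℂ) (u : ℂ) :
    ratValue (algebraMap (Polynomial ℂ) (RatFunc ℂ) p) u = p.eval u := by
  simp [ratValue, Polynomial.eval₂_id]

@[simp]
theorem ratValue_C (a u : ℂ) : ratValue (RatFunc.C a) u = a := by simp [ratValue]

@[simp]
theorem ratValue_X (u : ℂ) : ratValue RatFunc.X u = u := by simp [ratValue]

@[simp]
theorem ratValue_zero (u : ℂ) : ratValue 0 u = 0 := by simp [ratValue]

@[simp]
theorem ratValue_one (u : ℂ) : ratValue 1 u = 1 := by simp [ratValue]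

theorem ratValue_add (r s : RatFunc ℂ) :
    ∀ᶠ u in cofinite, ratValue (r + s) u = ratValue r u + ratValue s u := by
  filter_upwards [eventually_denom_ne_zero r, eventually_denom_ne_zero s] with u hr hs
  exact RatFunc.eval_add _ _ hr hs

theorem ratValue_mul (r s : RatFunc ℂ) :
    ∀ᶠ u in cofinite, ratValue (r * s) u = ratValue r u * ratValue s u := by
  filter_upwards [eventually_denom_ne_zero r, eventually_denom_ne_zero s] with u hr hs
  exact RatFunc.eval_mul _ _ hr hs

theorem ratValue_inv (r : RatFunc ℂ) :
    ∀ᶠ u in cofinite, ratValue r⁻¹ u = (ratValue r u)⁻¹ := by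
  rcases eq_or_ne r 0 with rfl | hr
  · simp
  filter_upwards [ratValue_mul r r⁻¹] with u hu
  rw [mul_inv_cancel₀ hr, ratValue_one] at hu
  exact eq_inv_of_mul_eq_one_right hu.symm

theorem ratValue_div (r s : RatFunc ℂ) :
    ∀ᶠ u in cofinite, ratValue (r / s) u = ratValue r u / ratValue s u := by
  filter_upwards [ratValue_mul r s⁻¹, ratValue_inv s] with u h1 h2
  rw [div_eq_mul_inv, h1, h2, div_eq_mul_inv]

theorem ratValue_pow (r : RatFunc ℂ) (k : ℕ) :
    ∀ᶠ u in cofinite, ratValue (r ^ k) u = ratValue r u ^ k := by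
  induction k with
  | zero => simp
  | succ k ih =>
    filter_upwards [ih, ratValue_mul (r ^ k) r] with u h1 h2
    rw [pow_succ, h2, h1, pow_succ]

theorem ratValue_zpow (r : RatFunc ℂ) (k : ℤ) :
    ∀ᶠ u in cofinite, ratValue (r ^ k) u = ratValue r u ^ k := by
  obtain ⟨k, rfl | rfl⟩ := k.eq_nat_or_neg
  · simpa using ratValue_pow r k
  · filter_upwards [ratValue_pow r k, ratValue_inv (r ^ k)] with u h1 h2
    rw [zpow_neg, zpow_natCast, h2, h1, zpow_neg, zpow_natCast]

/-- A rational function is determined by its values at infinitely many points. -/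
theorem ratFunc_eq_of_frequently {r s : RatFunc ℂ}
    (h : ∃ᶠ u in cofinite, ratValue r u = ratValue s u) : r = s := by
  have h1 : ∃ᶠ u in cofinite, (r - s).num.eval u = 0 := by
    refine (h.and_eventually ((ratValue_add (r - s) s).and
      (eventually_denom_ne_zero (r - s)))).mono ?_
    rintro u ⟨h1, h2, h3⟩
    rw [sub_add_cancel, h1, ratValue_eq_div (r - s)] at h2
    have : (r - s).num.eval u / (r - s).denom.eval u = 0 := by linear_combination -h2
    exact (div_eq_zero_iff.1 this).resolve_right h3
  have h2 := Polynomial.eq_zero_of_infinite_isRoot _ (frequently_cofinite_iff_infinite.1 h1)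
  exact sub_eq_zero.1 (RatFunc.num_eq_zero_iff.1 h2)

theorem ratFunc_eq_of_eventually {r s : RatFunc ℂ} {a : ℂ}
    (h : ∀ᶠ u in 𝓝[≠] a, ratValue r u = ratValue s u) : r = s :=
  ratFunc_eq_of_frequently (h.frequently.filter_mono (nhdsNE_le_cofinite a))

theorem eventually_differentiableAt_ratValue (r : RatFunc ℂ) :
    ∀ᶠ u in cofinite, DifferentiableAt ℂ (ratValue r) u := by
  filter_upwards [eventually_denom_ne_zero r] with u hu
  exact r.num.differentiableAt.div r.denom.differentiableAt hu

theorem exists_ratValue_eq_deriv (r : RatFunc ℂ) :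
    ∃ r' : RatFunc ℂ, ∀ᶠ u in cofinite, ratValue r' u = deriv (ratValue r) u := by
  refine ⟨algebraMap (Polynomial ℂ) (RatFunc ℂ) (Polynomial.derivative r.num * r.denom -
    r.num * Polynomial.derivative r.denom) /
    algebraMap (Polynomial ℂ) (RatFunc ℂ) (r.denom ^ 2), ?_⟩
  filter_upwards [eventually_denom_ne_zero r, ratValue_div (algebraMap (Polynomial ℂ) (RatFunc ℂ)
    (Polynomial.derivative r.num * r.denom - r.num * Polynomial.derivative r.denom))
    (algebraMap (Polynomial ℂ) (RatFunc ℂ) (r.denom ^ 2))] with u hu h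
  have hd : HasDerivAt (ratValue r) _ u := (r.num.hasDerivAt u).div (r.denom.hasDerivAt u) hu
  rw [h, hd.deriv, ratValue_algebraMap, ratValue_algebraMap]
  simp

/-- Rational functions are closed under first order differential operators with rational
coefficients. -/
theorem exists_ratValue_eq_operator (P Q S : Polynomial ℂ) (r : RatFunc ℂ) :
    ∃ r₁ : RatFunc ℂ, ∀ᶠ u in cofinite, ratValue r₁ u =
      (P.eval u * deriv (ratValue r) u + Q.eval u * ratValue r u) / S.eval u := by
  obtain ⟨r', hr'⟩ := exists_ratValue_eq_deriv r
  set A := algebraMap (Polynomial ℂ) (RatFunc ℂ) with hA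
  refine ⟨(A P * r' + A Q * r) / A S, ?_⟩
  filter_upwards [hr', ratValue_div (A P * r' + A Q * r) (A S), ratValue_add (A P * r') (A Q * r),
    ratValue_mul (A P) r', ratValue_mul (A Q) r] with u h1 h2 h3 h4 h5
  rw [h2, h3, h4, h5, h1]
  simp [hA]

theorem ratValue_eval₂_inv_X (p : Polynomial ℂ) :
    ∀ᶠ u in cofinite, ratValue (p.eval₂ RatFunc.C (RatFunc.X : RatFunc ℂ)⁻¹) u = p.eval u⁻¹ := by
  induction p using Polynomial.induction_on' with
  | add p q hp hq =>
    filter_upwards [hp, hq, ratValue_add (p.eval₂ RatFunc.C (RatFunc.X : RatFunc ℂ)⁻¹)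
      (q.eval₂ RatFunc.C (RatFunc.X : RatFunc ℂ)⁻¹)] with u h1 h2 h3
    rw [Polynomial.eval₂_add, h3, h1, h2, Polynomial.eval_add]
  | monomial k a =>
    filter_upwards [ratValue_mul (RatFunc.C a) ((RatFunc.X : RatFunc ℂ)⁻¹ ^ k),
      ratValue_pow (RatFunc.X : RatFunc ℂ)⁻¹ k, ratValue_inv (RatFunc.X : RatFunc ℂ)] with u h1 h2 h3
    rw [Polynomial.eval₂_monomial, h1, h2, h3, ratValue_X, ratValue_C, Polynomial.eval_monomial]

theorem ratValue_eval_inv_X (r : RatFunc ℂ) :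
    ∀ᶠ u in cofinite, ratValue (r.eval RatFunc.C (RatFunc.X : RatFunc ℂ)⁻¹) u = ratValue r u⁻¹ := by
  filter_upwards [ratValue_eval₂_inv_X r.num, ratValue_eval₂_inv_X r.denom,
    ratValue_div (r.num.eval₂ RatFunc.C (RatFunc.X : RatFunc ℂ)⁻¹)
      (r.denom.eval₂ RatFunc.C (RatFunc.X : RatFunc ℂ)⁻¹)] with u h1 h2 h3
  rw [RatFunc.eval, h3, h1, h2, ratValue_eq_div]

/-- A rational function that agrees near `a`, except possibly at `a`, with a function continuous
at `a` has no pole at `a`, hence agrees with it at `a` too. -/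
theorem ratValue_eventuallyEq_nhds {r : RatFunc ℂ} {a : ℂ} {g : ℂ → ℂ} (hg : ContinuousAt g a)
    (h : ∀ᶠ u in 𝓝[≠] a, ratValue r u = g u) : ∀ᶠ u in 𝓝 a, ratValue r u = g u := by
  have h1 : ∀ᶠ u in 𝓝[≠] a, r.num.eval u = g u * r.denom.eval u := by
    filter_upwards [h, nhdsNE_le_cofinite a (eventually_denom_ne_zero r)] with u hu hd
    rw [← hu, ratValue_eq_div, div_mul_cancel₀ _ hd]
  have h2 : r.num.eval a = g a * r.denom.eval a :=
    tendsto_nhds_unique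
      ((r.num.continuous.tendsto a).mono_left nhdsWithin_le_nhds |>.congr' h1)
      ((hg.mul r.denom.continuous.continuousAt).tendsto.mono_left nhdsWithin_le_nhds)
  have h3 : r.denom.eval a ≠ 0 := by
    intro h0
    rw [h0, mul_zero] at h2
    obtain ⟨x, y, hxy⟩ := r.isCoprime_num_denom
    have := congrArg (Polynomial.eval a) hxy
    simp [h0, h2] at this
  rw [← nhdsNE_sup_pure, eventually_sup, eventually_pure]
  exact ⟨h, by rw [ratValue_eq_div, h2, mul_div_cancel_right₀ _ h3]⟩

end RatValue

/-! ### Rising factorials and the constants `d^m_n` -/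

/-- The recurrence of the rising factorial, for negative indices as well; `a` is not an integer, so
that none of the inverted factors is zero. -/
theorem risingFact_add_one {a : ℂ} (ha : ∀ k : ℤ, a ≠ k) (k : ℤ) :
    risingFact a (k + 1) = risingFact a k * (a + k) := by
  rcases k with k | k
  · exact ascPochhammer_succ_eval k a
  · rcases k with _ | k
    · have : a - 1 ≠ 0 := fun h => ha 1 (by push_cast; linear_combination h)
      have h0 : risingFact a (Int.negSucc 0 + 1) = 1 := by
        change (ascPochhammer ℂ 0).eval a = 1
        simp
      rw [h0]
      simp [risingFact]
      field_simp
      ring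
    · have h1 : Int.negSucc (k + 1) + 1 = Int.negSucc k := by omega
      have h2 : a - ((k : ℂ) + 1) - 1 ≠ 0 := fun h =>
        ha (k + 2) (by push_cast; linear_combination h)
      have h3 := ascPochhammer_sub_one_succ_eval (a - ((k : ℂ) + 1)) (k + 1)
      rw [h1]
      simp only [risingFact]
      have h4 : a - (((k + 1 : ℕ) : ℂ) + 1) = a - ((k : ℂ) + 1) - 1 := by push_cast; ring
      have h5 : a + ((Int.negSucc (k + 1) : ℤ) : ℂ) = a - ((k : ℂ) + 1) - 1 := by
        rw [Int.cast_negSucc]; push_cast; ring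
      rw [h4, h5, h3, mul_inv, mul_comm, ← mul_assoc, mul_inv_cancel₀ h2, one_mul]

theorem risingFact_ne_zero {a : ℂ} (ha : ∀ k : ℤ, a ≠ k) (k : ℤ) : risingFact a k ≠ 0 := by
  have key : ∀ k : ℤ, a + k ≠ 0 := fun k h => ha (-k) (by push_cast; linear_combination h)
  induction k using Int.induction_on with
  | zero => simp [show risingFact a 0 = (ascPochhammer ℂ 0).eval a from rfl]
  | succ k ih => rw [risingFact_add_one ha]; exact mul_ne_zero ih (key _)
  | pred k ih =>
    intro h
    apply ih
    have := risingFact_add_one ha (-k - 1)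
    rw [sub_add_cancel, h, zero_mul] at this
    exact this

theorem octLead_zero : octLead 0 0 = 1 := by
  simp [octLead, risingFact]

section Constants

theorem ratio_ne_intCast {p q : ℤ} (hq : q ≠ 0) (h : ¬ q ∣ p) (k : ℤ) : (p : ℂ) / q ≠ k := by
  intro hk
  rw [div_eq_iff (by exact_mod_cast hq)] at hk
  exact h ⟨k, by rw [mul_comm]; exact_mod_cast hk⟩

theorem five_div_twelve_ne (k : ℤ) : (5 / 12 : ℂ) ≠ k := by
  simpa using ratio_ne_intCast (p := 5) (q := 12) (by norm_num) (by norm_num) k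

theorem thirteen_div_twelve_ne (k : ℤ) : (13 / 12 : ℂ) ≠ k := by
  simpa using ratio_ne_intCast (p := 13) (q := 12) (by norm_num) (by norm_num) k

theorem one_div_four_ne (k : ℤ) : (1 / 4 : ℂ) ≠ k := by
  simpa using ratio_ne_intCast (p := 1) (q := 4) (by norm_num) (by norm_num) k

theorem five_div_four_ne (k : ℤ) : (5 / 4 : ℂ) ≠ k := by
  simpa using ratio_ne_intCast (p := 5) (q := 4) (by norm_num) (by norm_num) k

theorem octLead_ne_zero (n m : ℤ) : octLead n m ≠ 0 := by
  refine div_ne_zero (mul_ne_zero (mul_ne_zero (zpow_ne_zero _ (by norm_num))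
    (zpow_ne_zero _ (by norm_num))) (mul_ne_zero ?_ ?_)) (mul_ne_zero ?_ ?_)
  exacts [risingFact_ne_zero five_div_twelve_ne _, risingFact_ne_zero thirteen_div_twelve_ne _,
    risingFact_ne_zero one_div_four_ne _, risingFact_ne_zero five_div_four_ne _]

theorem octLead_add_one_left (n m : ℤ) :
    octLead (n + 1) m * (7 / 12 + n - m) = octLead n m * (13 / 12 + m + n) := by
  have h1 := risingFact_add_one five_div_twelve_ne (m - n - 1)
  have h2 := risingFact_add_one thirteen_div_twelve_ne (m + n)
  rw [sub_add_cancel] at h1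
  have h3 := risingFact_ne_zero one_div_four_ne m
  have h4 := risingFact_ne_zero five_div_four_ne m
  have e1 : m + (n + 1) = m + n + 1 := by ring
  have e2 : m - (n + 1) = m - n - 1 := by ring
  rw [octLead, octLead, e1, e2, h1, h2, zpow_add_one₀ (by norm_num)]
  field_simp
  push_cast
  ring

theorem octLead_add_one_right (n m : ℤ) :
    octLead n (m + 1) * ((1 / 4 + m) * (5 / 4 + m)) =
      -27 * octLead n m * ((5 / 12 + m - n) * (13 / 12 + m + n)) := by
  have h1 := risingFact_add_one five_div_twelve_ne (m - n)
  have h2 := risingFact_add_one thirteen_div_twelve_ne (m + n)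
  have h3 := risingFact_ne_zero one_div_four_ne m
  have h4 := risingFact_ne_zero five_div_four_ne m
  have h5 := risingFact_ne_zero one_div_four_ne (m + 1)
  have h6 := risingFact_ne_zero five_div_four_ne (m + 1)
  rw [risingFact_add_one one_div_four_ne m] at h5
  rw [risingFact_add_one five_div_four_ne m] at h6
  have e1 : m + 1 + n = m + n + 1 := by ring
  have e2 : m + 1 - n = m - n + 1 := by ring
  have e3 : (3 : ℂ) ^ (3 * (m + 1)) = 3 ^ (3 * m) * 27 := by
    rw [mul_add, zpow_add₀ (by norm_num)]; norm_num
  rw [octLead, octLead, e1, e2, h1, h2, risingFact_add_one one_div_four_ne m,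
    risingFact_add_one five_div_four_ne m, zpow_add_one₀ (by norm_num), e3]
  have h7 := right_ne_zero_of_mul h5
  have h8 := right_ne_zero_of_mul h6
  generalize (1 / 4 + (m : ℂ)) = x at *
  generalize (5 / 4 + (m : ℂ)) = y at *
  field_simp
  push_cast
  ring

end Constants

/-! ### The inversion `u ↦ 1 / u` and the four moves on the index lattice -/

section Inversion

variable {u E y y' α β e m n : ℂ}

theorem octPf_inv (hu : u ≠ 0) : octPf u⁻¹ = octPf u / u ^ 2 := by
  unfold octPf; field_simp; ring

theorem octPe_inv (hu : u ≠ 0) : octPe u⁻¹ = octPe u / u ^ 3 := by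
  unfold octPe; field_simp; ring

/-- The derivative at `u` of `E(u) y(1 / u)`, where `E(u)` is a multiple of
`(1 - u) ^ (-1 - 4 m) u ^ (3 n + 2 m)`. -/
noncomputable def invertedDeriv (n m u y y' : ℂ) : ℂ :=
  ((1 + 4 * m) / (1 - u) + (3 * n + 2 * m) / u) * y - y' / u ^ 2

/-- The substitution `u ↦ 1 / u` carries the step `n ↦ n - 1` for `r` to that for the conjugate. -/
theorem raiseBeta_inversion (hu : u ≠ 0) (hu1 : 1 - u ≠ 0) (hpf : octPf u ≠ 0)
    (hα : α = -1 / 12 - m - n) (hβ : β = 5 / 12 + m - n) (hα0 : α ≠ 0) (hβ0 : β ≠ 0) :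
    raiseBeta β u (E * y) (E * invertedDeriv n m u y y') =
      E * (α / β) * (u ^ 3)⁻¹ * raiseBeta α u⁻¹ y y' := by
  unfold raiseBeta invertedDeriv
  rw [octPf_inv hu]
  field_simp
  rw [hα, hβ]
  ring

theorem mul_lowerBeta (he : e ≠ 0) : e * lowerBeta β e u y y' =
    u * (1 - u) * octPf u * y' + (e * octPe u + β * (u * (1 - u) * (3 * u + 21))) * y := by
  rw [lowerBeta, mul_div_cancel₀ _ he]

/-- The substitution `u ↦ 1 / u` carries the step `n ↦ n + 1` for `r` to that for the conjugate. -/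
theorem lowerBeta_inversion {e' : ℂ} (hu : u ≠ 0) (hu1 : 1 - u ≠ 0) (he : e ≠ 0) (he' : e' ≠ 0)
    (hα : α = -1 / 12 - m - n) (hβ : β = 5 / 12 + m - n)
    (hee : e = 3 / 4 - m - (α / 2 + 1 / 2)) (hee' : e' = 5 / 4 + m - (β / 2 + 1 / 2)) :
    lowerBeta β e' u (E * y) (E * invertedDeriv n m u y y') =
      E * (e / e') * u ^ 3 * lowerBeta α e u⁻¹ y y' := by
  apply mul_left_cancel₀ he'
  rw [mul_lowerBeta he']
  have : e' * (E * (e / e') * u ^ 3 * lowerBeta α e u⁻¹ y y') =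
      E * u ^ 3 * (e * lowerBeta α e u⁻¹ y y') := by field_simp
  rw [this, mul_lowerBeta he, octPf_inv hu, octPe_inv hu, invertedDeriv]
  rw [hee, hee', hα, hβ]
  field_simp
  unfold octPf octPe
  ring

/-- The substitution `u ↦ 1 / u` carries the step `m ↦ m + 1` for `r` to that for the conjugate. -/
theorem raiseBoth_inversion {κ c : ℂ} (hu : u ≠ 0) (hu1 : 1 - u ≠ 0) (he : e ≠ 0)
    (hα : α = -1 / 12 - m - n) (hβ : β = 5 / 12 + m - n)
    (hee : e = 3 / 4 - m - 1) (hκ : κ = β / 2 * (c - (β / 2 + 1 / 2)) / c) (hκ0 : κ ≠ 0) :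
    raiseBoth β c u (E * y) (E * invertedDeriv n m u y y') =
      E * (e / (108 * κ)) * ((1 - u) ^ 4)⁻¹ * u ^ 2 * lowerBeta α e u⁻¹ y y' := by
  have : E * (e / (108 * κ)) * ((1 - u) ^ 4)⁻¹ * u ^ 2 * lowerBeta α e u⁻¹ y y' =
      E / (108 * κ) * ((1 - u) ^ 4)⁻¹ * u ^ 2 * (e * lowerBeta α e u⁻¹ y y') := by field_simp
  rw [this, mul_lowerBeta he, octPf_inv hu, octPe_inv hu, raiseBoth, ← hκ, invertedDeriv, hee, hα,
    hβ]
  field_simp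
  unfold octPf octPe
  ring

/-- The substitution `u ↦ 1 / u` carries the step `m ↦ m - 1` for `r` to that for the conjugate. -/
theorem lowerBoth_inversion {κ c : ℂ} (hu : u ≠ 0) (hu1 : 1 - u ≠ 0) (he : e ≠ 0)
    (hα : α = -1 / 12 - m - n) (hβ : β = 5 / 12 + m - n)
    (hee : e = 5 / 4 + m - 1) (hκ : κ = α / 2 * (c - (α / 2 + 1 / 2)) / c) (hκ0 : κ ≠ 0) :
    lowerBeta β e u (E * y) (E * invertedDeriv n m u y y') =
      E * (108 * κ / e) * (1 - u) ^ 4 * (u ^ 2)⁻¹ * raiseBoth α c u⁻¹ y y' := by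
  apply mul_left_cancel₀ he
  have hu3 : (1 - u⁻¹) ^ 3 = -(1 - u) ^ 3 / u ^ 3 := by field_simp; ring
  rw [mul_lowerBeta he, raiseBoth, ← hκ, hu3, octPf_inv hu,
    invertedDeriv, hα, hβ, show m = e - 1 / 4 by rw [hee]; ring]
  field_simp
  unfold octPf octPe
  ring

end Inversion

/-- The factor of the conjugate function: the conjugate of `r` is, up to the factor
`(1 - u) ^ (-1 - 4 m)`, the function `(d^m_n)⁻¹ u ^ (3 n + 2 m) r(1 / u)`. -/
noncomputable def conjFactor (n m : ℤ) (u : ℂ) : ℂ :=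
  (1 - u) ^ (-1 - 4 * m) * ((octLead n m)⁻¹ * u ^ (3 * n + 2 * m))

theorem hasDerivAt_conjFactor (n m : ℤ) {u : ℂ} (hu : u ≠ 0) (hu1 : 1 - u ≠ 0) :
    HasDerivAt (conjFactor n m)
      (conjFactor n m u * ((1 + 4 * m) / (1 - u) + (3 * n + 2 * m) / u)) u := by
  have h1 := (hasDerivAt_zpow (-1 - 4 * m) (1 - u) (Or.inl hu1)).comp u
    ((hasDerivAt_id u).const_sub 1)
  have h2 := (hasDerivAt_zpow (3 * n + 2 * m) u (Or.inl hu)).const_mul (octLead n m)⁻¹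
  refine (h1.mul h2).congr_deriv ?_
  simp only [Function.comp, conjFactor]
  rw [zpow_sub_one₀ hu, zpow_sub_one₀ hu1]
  push_cast
  field_simp
  ring

/-- A step of the index lattice changes the conjugate factor by powers of `u` and `1 - u` and by the
ratio of the constants `d^m_n`. -/
theorem conjFactor_mul {n m n₁ m₁ : ℤ} (i j : ℤ) {u x y : ℂ} (hu : u ≠ 0) (hu1 : 1 - u ≠ 0)
    (hi : 3 * n₁ + 2 * m₁ = 3 * n + 2 * m + i) (hj : -1 - 4 * m₁ = -1 - 4 * m + j) (hy : y ≠ 0)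
    (h : octLead n₁ m₁ * x = octLead n m * y) :
    conjFactor n m u * (x / y) * (1 - u) ^ j * u ^ i = conjFactor n₁ m₁ u := by
  have h1 := octLead_ne_zero n m
  have h2 := octLead_ne_zero n₁ m₁
  have h3 : (octLead n m)⁻¹ * (x / y) = (octLead n₁ m₁)⁻¹ := by
    field_simp
    linear_combination h
  rw [conjFactor, conjFactor, hi, hj, zpow_add₀ hu (3 * n + 2 * m) i,
    zpow_add₀ hu1 (-1 - 4 * m) j, ← h3]
  generalize u ^ (3 * n + 2 * m) = A
  generalize (1 - u) ^ (-1 - 4 * m) = B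
  ring

theorem eventually_hasDerivAt_conj (n m : ℤ) (r : RatFunc ℂ) :
    ∀ᶠ u in cofinite, HasDerivAt (fun u => conjFactor n m u * ratValue r u⁻¹)
      (conjFactor n m u * invertedDeriv n m u (ratValue r u⁻¹) (deriv (ratValue r) u⁻¹)) u := by
  filter_upwards [inv_injective.tendsto_cofinite.eventually
    (eventually_differentiableAt_ratValue r), eventually_cofinite_ne 0, eventually_cofinite_ne 1]
    with u hr hu hu1
  have hu1 : 1 - u ≠ 0 := sub_ne_zero.2 hu1.symm
  refine ((hasDerivAt_conjFactor n m hu hu1).mul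
    (hr.hasDerivAt.comp u (hasDerivAt_inv hu))).congr_deriv ?_
  simp only [Function.comp, invertedDeriv]
  field_simp
  ring

theorem IsPullback.congr {β c : ℂ} {f g : ℂ → ℂ} (hf : IsPullback β c f)
    (h : ∀ᶠ u in cofinite, f u = g u) : IsPullback β c g := by
  unfold IsPullback at *
  filter_upwards [hf, nhdsNE_le_cofinite 0 h] with u h1 h2
  rw [h1, h2]

/-- `r` is the octahedral function of index `(n, m)`, and its inversion is the conjugate one.
Both relations are required near, but not at, the origin. -/
structure IsOctPair (n m : ℤ) (r : RatFunc ℂ) : Prop where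
  pullback : IsPullback (-1 / 12 - m - n) (3 / 4 - m) (ratValue r)
  pullback_conj : IsPullback (5 / 12 + m - n) (5 / 4 + m)
    fun u => conjFactor n m u * ratValue r u⁻¹

theorem nonResonant_oct (n m : ℤ) : NonResonant (-1 / 12 - m - n) (3 / 4 - m) :=
  nonResonant_base.shift (-m - n) (-m) (by push_cast; ring) (by push_cast; ring)

theorem nonResonant_oct_conj (n m : ℤ) : NonResonant (5 / 12 + m - n) (5 / 4 + m) :=
  nonResonant_base_conj.shift (m - n) m (by push_cast; ring) (by ring)

theorem isOctPair_zero : IsOctPair 0 0 1 where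
  pullback := by
    simpa using isPullback_base.congr (g := ratValue 1) (by simp)
  pullback_conj := by
    simpa [conjFactor, octLead_zero] using isPullback_base_conj

namespace IsOctPair

variable {n m : ℤ} {r : RatFunc ℂ}

theorem differentiableAt (r : RatFunc ℂ) :
    ∀ᶠ u in 𝓝[≠] (0 : ℂ), DifferentiableAt ℂ (ratValue r) u :=
  nhdsNE_le_cofinite 0 (eventually_differentiableAt_ratValue r)

theorem differentiableAt_conj (n m : ℤ) (r : RatFunc ℂ) :
    ∀ᶠ u in 𝓝[≠] (0 : ℂ), DifferentiableAt ℂ (fun u => conjFactor n m u * ratValue r u⁻¹) u :=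
  nhdsNE_le_cofinite 0 ((eventually_hasDerivAt_conj n m r).mono fun _ h => h.differentiableAt)

/-- Assembles a move on the index lattice from its two first order operators `T`, `T'` and their
compatibility with the inversion. -/
theorem move {n₁ m₁ : ℤ} {T T' : ℂ → ℂ → ℂ → ℂ} {P Q S : Polynomial ℂ}
    (hT : ∀ u y y', T u y y' = (P.eval u * y' + Q.eval u * y) / S.eval u)
    (h : IsPullback (-1 / 12 - m₁ - n₁) (3 / 4 - m₁)
      fun u => T u (ratValue r u) (deriv (ratValue r) u))
    (h' : IsPullback (5 / 12 + m₁ - n₁) (5 / 4 + m₁)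
      fun u => T' u (conjFactor n m u * ratValue r u⁻¹)
        (deriv (fun u => conjFactor n m u * ratValue r u⁻¹) u))
    (hTT : ∀ u y y', u ≠ 0 → 1 - u ≠ 0 → octPf u ≠ 0 →
      T' u (conjFactor n m u * y) (conjFactor n m u * invertedDeriv n m u y y') =
        conjFactor n₁ m₁ u * T u⁻¹ y y') :
    ∃ r₁, IsOctPair n₁ m₁ r₁ := by
  obtain ⟨r₁, hr₁⟩ := exists_ratValue_eq_operator P Q S r
  simp only [← hT] at hr₁
  refine ⟨r₁, h.congr (hr₁.mono fun u hu => hu.symm), h'.congr ?_⟩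
  have hpf : ∀ᶠ u in cofinite, octPf u ≠ 0 := by
    have := eventually_cofinite_eval_ne_zero
      (p := (1 + 14 * Polynomial.X + Polynomial.X ^ 2 : Polynomial ℂ))
      (fun h0 => by simpa using congrArg (Polynomial.eval 0) h0)
    simpa [octPf] using this
  filter_upwards [eventually_hasDerivAt_conj n m r, hpf, eventually_cofinite_ne 0,
    eventually_cofinite_ne 1, inv_injective.tendsto_cofinite.eventually hr₁] with u h1 h2 h3 h4 h5
  rw [h1.deriv, hTT _ _ _ h3 (sub_ne_zero.2 h4.symm) h2, h5]

open Polynomial in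
theorem sub_one_left (h : IsOctPair n m r) : ∃ r₁, IsOctPair (n - 1) m r₁ := by
  have hα := nonResonant_oct n m
  have hβ := nonResonant_oct_conj n m
  refine move (n := n) (m := m) (r := r) (T := raiseBeta (-1 / 12 - m - n))
    (T' := raiseBeta (5 / 12 + m - n))
    (P := X * (1 - X)) (Q := C ((-1 / 12 - m - n : ℂ) / 2) * (1 - 5 * X))
    (S := C ((-1 / 12 - m - n : ℂ) / 2) * (1 + 14 * X + X ^ 2) ^ 2)
    (fun u y y' => by simp [raiseBeta, octPf]) ?_ ?_ fun u y y' hu hu1 hpf => ?_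
  · convert h.pullback.raiseBeta hα (differentiableAt r) using 1
    push_cast; ring
  · convert h.pullback_conj.raiseBeta hβ (differentiableAt_conj n m r) using 1
    push_cast; ring
  · rw [raiseBeta_inversion hu hu1 hpf rfl rfl hα.ne_zero hβ.ne_zero]
    congr 1
    have h1 := octLead_add_one_left (n - 1) m
    have h2 : octLead (n - 1) m * (-1 / 12 - m - n) = octLead n m * (5 / 12 + m - n) := by
      rw [sub_add_cancel] at h1
      push_cast at h1
      linear_combination h1
    rw [← conjFactor_mul (-3) 0 hu hu1 (by ring) (by ring) hβ.ne_zero h2, zpow_zero, mul_one,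
      zpow_neg, zpow_ofNat]

open Polynomial in
theorem add_one_left (h : IsOctPair n m r) : ∃ r₁, IsOctPair (n + 1) m r₁ := by
  have hα := nonResonant_oct n m
  have hβ := nonResonant_oct_conj n m
  set e : ℂ := 3 / 4 - m - ((-1 / 12 - m - n) / 2 + 1 / 2) with he
  set e' : ℂ := 5 / 4 + m - ((5 / 12 + m - n) / 2 + 1 / 2) with he'
  refine move (n := n) (m := m) (r := r) (T := lowerBeta (-1 / 12 - m - n) e)
    (T' := lowerBeta (5 / 12 + m - n) e')
    (P := X * (1 - X) * (1 + 14 * X + X ^ 2))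
    (Q := C e * ((1 + X) * (1 - 34 * X + X ^ 2)) +
      C (-1 / 12 - m - n : ℂ) * (X * (1 - X) * (3 * X + 21)))
    (S := C e)
    (fun u y y' => by simp [lowerBeta, octPf, octPe]) ?_ ?_ fun u y y' hu hu1 hpf => ?_
  · convert h.pullback.lowerBeta hα (differentiableAt r) using 1
    push_cast; ring
  · convert h.pullback_conj.lowerBeta hβ (differentiableAt_conj n m r) using 1
    push_cast; ring
  · rw [lowerBeta_inversion hu hu1 hα.bot_sub_ne_zero hβ.bot_sub_ne_zero rfl rfl he he']
    congr 1
    have h1 := octLead_add_one_left n m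
    have h2 : octLead (n + 1) m * e = octLead n m * e' := by
      rw [he, he']
      linear_combination (1 / 2) * h1
    rw [← conjFactor_mul 3 0 hu hu1 (by ring) (by ring) hβ.bot_sub_ne_zero h2, zpow_zero, mul_one,
      zpow_ofNat]

open Polynomial in
theorem add_one_right (h : IsOctPair n m r) : ∃ r₁, IsOctPair n (m + 1) r₁ := by
  have hα := nonResonant_oct n m
  have hβ := nonResonant_oct_conj n m
  set e : ℂ := 3 / 4 - m - 1 with he
  refine move (n := n) (m := m) (r := r) (T := lowerBeta (-1 / 12 - m - n) e)
    (T' := raiseBoth (5 / 12 + m - n) (5 / 4 + m))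
    (P := X * (1 - X) * (1 + 14 * X + X ^ 2))
    (Q := C e * ((1 + X) * (1 - 34 * X + X ^ 2)) +
      C (-1 / 12 - m - n : ℂ) * (X * (1 - X) * (3 * X + 21)))
    (S := C e)
    (fun u y y' => by simp [lowerBeta, octPf, octPe]) ?_ ?_ fun u y y' hu hu1 hpf => ?_
  · convert h.pullback.lowerBoth hα (differentiableAt r) using 1 <;> push_cast <;> ring
  · convert h.pullback_conj.raiseBoth hβ (differentiableAt_conj n m r) using 1 <;>
      push_cast <;> ring
  · have h6 := hβ.bot_ne_zero
    set κ : ℂ := (5 / 12 + m - n) / 2 * (5 / 4 + m - ((5 / 12 + m - n) / 2 + 1 / 2)) / (5 / 4 + m)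
      with hκ
    have h4 : κ ≠ 0 := div_ne_zero (mul_ne_zero (div_ne_zero hβ.ne_zero two_ne_zero)
      hβ.bot_sub_ne_zero) h6
    rw [raiseBoth_inversion hu hu1 hα.bot_sub_one_ne_zero rfl rfl he hκ h4]
    congr 1
    have h1 := octLead_add_one_right n m
    have h5 : octLead n (m + 1) * e = octLead n m * (108 * κ) := by
      have : κ * (5 / 4 + m) =
        (5 / 12 + m - n) / 2 * (5 / 4 + m - ((5 / 12 + m - n) / 2 + 1 / 2)) := by
        rw [hκ, div_mul_cancel₀ _ h6]
      apply mul_right_cancel₀ h6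
      rw [he]; linear_combination -h1 - 108 * octLead n m * this
    rw [← conjFactor_mul 2 (-4) hu hu1 (by ring) (by ring)
      (mul_ne_zero (by norm_num) h4) h5, zpow_neg, zpow_ofNat, zpow_ofNat]

open Polynomial in
theorem sub_one_right (h : IsOctPair n m r) : ∃ r₁, IsOctPair n (m - 1) r₁ := by
  have hα := nonResonant_oct n m
  have hβ := nonResonant_oct_conj n m
  have h6 := hα.bot_ne_zero
  set e : ℂ := 5 / 4 + m - 1 with he
  set κ : ℂ := (-1 / 12 - m - n) / 2 * (3 / 4 - m - ((-1 / 12 - m - n) / 2 + 1 / 2)) / (3 / 4 - m)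
    with hκ
  refine move (n := n) (m := m) (r := r) (T := raiseBoth (-1 / 12 - m - n) (3 / 4 - m))
    (T' := lowerBeta (5 / 12 + m - n) e)
    (P := 1 + 14 * X + X ^ 2)
    (Q := C (-1 / 12 - m - n : ℂ) * (3 * X + 21))
    (S := C (108 * κ) * (1 - X) ^ 3)
    (fun u y y' => by simp [raiseBoth, octPf, hκ]) ?_ ?_ fun u y y' hu hu1 hpf => ?_
  · convert h.pullback.raiseBoth hα (differentiableAt r) using 1 <;>
      push_cast <;> ring
  · convert h.pullback_conj.lowerBoth hβ (differentiableAt_conj n m r) using 1 <;>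
      push_cast <;> ring
  · have h4 : κ ≠ 0 := div_ne_zero (mul_ne_zero (div_ne_zero hα.ne_zero two_ne_zero)
      hα.bot_sub_ne_zero) h6
    rw [lowerBoth_inversion hu hu1 hβ.bot_sub_one_ne_zero rfl rfl he hκ h4]
    congr 1
    have h1 := octLead_add_one_right n (m - 1)
    rw [sub_add_cancel] at h1
    push_cast at h1
    have h5 : octLead n (m - 1) * (108 * κ) = octLead n m * e := by
      have : κ * (3 / 4 - m) =
        (-1 / 12 - m - n) / 2 * (3 / 4 - m - ((-1 / 12 - m - n) / 2 + 1 / 2)) := by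
        rw [hκ, div_mul_cancel₀ _ h6]
      apply mul_right_cancel₀ h6
      rw [he]; linear_combination h1 + 108 * octLead n (m - 1) * this
    rw [← conjFactor_mul (-2) 4 hu hu1 (by ring) (by ring) hβ.bot_sub_one_ne_zero h5,
      zpow_neg, zpow_ofNat, zpow_ofNat]

end IsOctPair

theorem exists_isOctPair (n m : ℤ) : ∃ r, IsOctPair n m r := by
  have h1 : ∀ n : ℤ, ∃ r, IsOctPair n 0 r := fun n => by
    induction n using Int.induction_on with
    | zero => exact ⟨1, isOctPair_zero⟩
    | succ k ih => exact ih.elim fun r hr => hr.add_one_left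
    | pred k ih => exact ih.elim fun r hr => hr.sub_one_left
  induction m using Int.induction_on with
  | zero => exact h1 n
  | succ k ih => exact ih.elim fun r hr => hr.add_one_right
  | pred k ih => exact ih.elim fun r hr => hr.sub_one_right

/-! ### From pullbacks to octahedral functions -/

theorem IsPullback.eventually_eq {β c : ℂ} {f : ℂ → ℂ} (hf : IsPullback β c f) :
    ∀ᶠ u in 𝓝[≠] (0 : ℂ), f u = gaussPullback β c u := by
  unfold IsPullback at hf
  filter_upwards [hf, nhdsWithin_le_nhds eventually_regularPoint] with u h hu
  rw [gaussPullback, h, ← mul_assoc, mul_comm (octPe u ^ (-β)), octPe_cpow_mul_cpow_neg hu.pe_ne,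
    one_mul]

theorem halfF_oct (n m : ℤ) (x : ℂ) : halfF (-1 / 12 - m - n) (3 / 4 - m) x =
    ₂F₁ (-1 / 24 - (m : ℂ) / 2 - (n : ℂ) / 2) (11 / 24 - (m : ℂ) / 2 - (n : ℂ) / 2)
      (3 / 4 - (m : ℂ)) x := by
  rw [halfF]
  congr 1 <;> ring

theorem halfF_oct_conj (n m : ℤ) (x : ℂ) : halfF (5 / 12 + m - n) (5 / 4 + m) x =
    ₂F₁ (5 / 24 + (m : ℂ) / 2 - (n : ℂ) / 2) (17 / 24 + (m : ℂ) / 2 - (n : ℂ) / 2)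
      (5 / 4 + (m : ℂ)) x := by
  rw [halfF]
  congr 1 <;> ring

/-- The relation at `u = 0` itself is automatic: `r` has a finite limit there, hence no pole. -/
theorem isOctahedral_iff {n m : ℤ} {r : RatFunc ℂ} :
    IsOctahedral n m r ↔ IsPullback (-1 / 12 - m - n) (3 / 4 - m) (ratValue r) := by
  simp only [IsOctahedral, ← halfF_oct]
  refine ⟨fun h => nhdsWithin_le_nhds h, fun h => ?_⟩
  filter_upwards [ratValue_eventuallyEq_nhds
    (analyticAt_gaussPullback (nonResonant_oct n m)).continuousAt h.eventually_eq,
    eventually_regularPoint] with u hu hr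
  rw [hu, gaussPullback, ← mul_assoc, octPe_cpow_mul_cpow_neg hr.pe_ne, one_mul]

theorem isOctahedralConj_iff {n m : ℤ} {s : RatFunc ℂ} :
    IsOctahedralConj n m s ↔ IsPullback (5 / 12 + m - n) (5 / 4 + m)
      fun u => (1 - u) ^ (-1 - 4 * m) * ratValue s u := by
  simp only [IsOctahedralConj, ← halfF_oct_conj]
  refine ⟨fun h => (h.filter_mono nhdsWithin_le_nhds).mono fun u hu => by rw [hu, mul_assoc], fun h => ?_⟩
  have hc : ContinuousAt (fun u : ℂ => ((1 - u) ^ (-1 - 4 * m))⁻¹ *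
      gaussPullback (5 / 12 + m - n) (5 / 4 + m) u) 0 := by
    refine ContinuousAt.mul (ContinuousAt.inv₀ (ContinuousAt.zpow₀ (by fun_prop) _ ?_) ?_)
      (analyticAt_gaussPullback (nonResonant_oct_conj n m)).continuousAt
    · simp
    · simp
  have hs : ∀ᶠ u in 𝓝[≠] (0 : ℂ), ratValue s u = ((1 - u) ^ (-1 - 4 * m))⁻¹ *
      gaussPullback (5 / 12 + m - n) (5 / 4 + m) u := by
    filter_upwards [h.eventually_eq, nhdsWithin_le_nhds eventually_regularPoint] with u hu hr
    rw [← hu, inv_mul_cancel_left₀ (zpow_ne_zero _ hr.ne_one)]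
  filter_upwards [ratValue_eventuallyEq_nhds hc hs, eventually_regularPoint] with u hu hr
  rw [hu, gaussPullback, mul_assoc, mul_inv_cancel_left₀ (zpow_ne_zero _ hr.ne_one), ← mul_assoc,
    octPe_cpow_mul_cpow_neg hr.pe_ne, one_mul]

theorem IsOctahedral.unique {n m : ℤ} {r r' : RatFunc ℂ} (h : IsOctahedral n m r)
    (h' : IsOctahedral n m r') : r = r' := by
  apply ratFunc_eq_of_eventually (a := 0)
  filter_upwards [(isOctahedral_iff.1 h).eventually_eq, (isOctahedral_iff.1 h').eventually_eq]
    with u a b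
  rw [a, b]

theorem IsOctahedralConj.unique {n m : ℤ} {s s' : RatFunc ℂ} (h : IsOctahedralConj n m s)
    (h' : IsOctahedralConj n m s') : s = s' := by
  apply ratFunc_eq_of_eventually (a := 0)
  filter_upwards [(isOctahedralConj_iff.1 h).eventually_eq,
    (isOctahedralConj_iff.1 h').eventually_eq, nhdsWithin_le_nhds eventually_regularPoint]
    with u a b hr
  exact mul_left_cancel₀ (zpow_ne_zero _ hr.ne_one) (a.trans b.symm)

theorem IsOctahedral.ratValue_zero {n m : ℤ} {r : RatFunc ℂ} (h : IsOctahedral n m r) :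
    ratValue r 0 = 1 := by
  simpa [octMap_zero, octPe_zero] using h.self_of_nhds.symm

theorem IsOctahedralConj.ratValue_zero {n m : ℤ} {s : RatFunc ℂ} (h : IsOctahedralConj n m s) :
    ratValue s 0 = 1 := by
  simpa [octMap_zero, octPe_zero] using h.self_of_nhds.symm

/-- A nonzero value at a point excludes a pole there, a pole having the junk value `0`. -/
theorem continuousAt_ratValue {r : RatFunc ℂ} {a : ℂ} (h : ratValue r a ≠ 0) :
    ContinuousAt (ratValue r) a :=
  r.num.continuous.continuousAt.div r.denom.continuous.continuousAt
    (RatFunc.eval₂_denom_ne_zero h)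

/-- The rational function `(d^m_n)⁻¹ u ^ (3 n + 2 m) r(1 / u)`. -/
noncomputable def conjRat (n m : ℤ) (r : RatFunc ℂ) : RatFunc ℂ :=
  RatFunc.C (octLead n m)⁻¹ * RatFunc.X ^ (3 * n + 2 * m) *
    r.eval RatFunc.C (RatFunc.X : RatFunc ℂ)⁻¹

theorem ratValue_conjRat (n m : ℤ) (r : RatFunc ℂ) : ∀ᶠ u in cofinite,
    ratValue (conjRat n m r) u = (octLead n m)⁻¹ * u ^ (3 * n + 2 * m) * ratValue r u⁻¹ := by
  filter_upwards [ratValue_eval_inv_X r, ratValue_zpow RatFunc.X (3 * n + 2 * m),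
    ratValue_mul (RatFunc.C (octLead n m)⁻¹) (RatFunc.X ^ (3 * n + 2 * m)),
    ratValue_mul (RatFunc.C (octLead n m)⁻¹ * RatFunc.X ^ (3 * n + 2 * m))
      (r.eval RatFunc.C (RatFunc.X : RatFunc ℂ)⁻¹)] with u h1 h2 h3 h4
  rw [conjRat, h4, h3, h1, h2, ratValue_C, ratValue_X]

theorem IsOctPair.isOctahedral {n m : ℤ} {r : RatFunc ℂ} (h : IsOctPair n m r) :
    IsOctahedral n m r := isOctahedral_iff.2 h.pullback

theorem IsOctPair.isOctahedralConj {n m : ℤ} {r : RatFunc ℂ} (h : IsOctPair n m r) :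
    IsOctahedralConj n m (conjRat n m r) := by
  refine isOctahedralConj_iff.2 (h.pullback_conj.congr ?_)
  filter_upwards [ratValue_conjRat n m r] with u hu
  rw [hu, conjFactor, mul_assoc]

/-- The behaviour of `r` at infinity is that of its inversion at the origin. -/
theorem isEquivalent_of_conjRat {n m : ℤ} {r : RatFunc ℂ} (h : ratValue (conjRat n m r) 0 = 1) :
    Asymptotics.IsEquivalent (Bornology.cobounded ℂ) (ratValue r)
      (fun u : ℂ => octLead n m * u ^ (3 * n + 2 * m)) := by
  have hd := octLead_ne_zero n m
  have hne : ∀ᶠ u in Bornology.cobounded ℂ, octLead n m * u ^ (3 * n + 2 * m) ≠ 0 := by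
    filter_upwards [Bornology.le_cofinite ℂ (eventually_cofinite_ne (0 : ℂ))] with u hu
    exact mul_ne_zero hd (zpow_ne_zero _ hu)
  rw [Asymptotics.isEquivalent_iff_tendsto_one hne]
  have h1 : Tendsto (fun u => ratValue (conjRat n m r) u⁻¹) (Bornology.cobounded ℂ) (𝓝 1) := by
    have := (continuousAt_ratValue (h ▸ one_ne_zero)).tendsto.comp
      (tendsto_inv₀_cobounded (α := ℂ))
    rwa [h] at this
  refine h1.congr' ?_
  filter_upwards [Bornology.le_cofinite ℂ (eventually_cofinite_ne (0 : ℂ)),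
    Bornology.le_cofinite ℂ (inv_injective.tendsto_cofinite.eventually (ratValue_conjRat n m r))]
    with u hu h2
  have hu' : u ^ (3 * n + 2 * m) ≠ 0 := zpow_ne_zero _ hu
  rw [h2, inv_inv, inv_zpow, Pi.div_apply]
  field_simp

/-! ### The polynomial case -/

theorem exists_polynomial_lowerBeta (β e : ℂ) (p : Polynomial ℂ) : ∃ q : Polynomial ℂ,
    ∀ u, lowerBeta β e u (p.eval u) (deriv (fun u => p.eval u) u) = q.eval u := by
  open Polynomial in
  refine ⟨(X * (1 - X) * (1 + 14 * X + X ^ 2) * derivative p +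
    (C e * ((1 + X) * (1 - 34 * X + X ^ 2)) + C β * (X * (1 - X) * (3 * X + 21))) * p) * C e⁻¹,
    fun u => ?_⟩
  simp [lowerBeta, octPf, octPe, div_eq_mul_inv]

theorem exists_polynomial_isOctahedral (n m : ℕ) : ∃ p : Polynomial ℂ,
    IsOctahedral n m (algebraMap (Polynomial ℂ) (RatFunc ℂ) p) := by
  have key : ∃ p : Polynomial ℂ, IsPullback (-1 / 12 - (m : ℤ) - (n : ℤ)) (3 / 4 - (m : ℤ))
      fun u => p.eval u := by
    have hd (p : Polynomial ℂ) : ∀ᶠ u in 𝓝[≠] (0 : ℂ), DifferentiableAt ℂ (fun u => p.eval u) u :=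
      Eventually.of_forall fun u => p.differentiableAt
    have h1 : ∃ p : Polynomial ℂ, IsPullback (-1 / 12 - (0 : ℤ) - (n : ℤ)) (3 / 4 - (0 : ℤ))
        fun u => p.eval u := by
      induction n with
      | zero => exact ⟨1, by simpa using isPullback_base⟩
      | succ n ih =>
        obtain ⟨p, hp⟩ := ih
        have h2 := hp.lowerBeta (nonResonant_oct n 0) (hd p)
        obtain ⟨q, hq⟩ := exists_polynomial_lowerBeta (-1 / 12 - (0 : ℤ) - (n : ℤ))
          (3 / 4 - (0 : ℤ) - ((-1 / 12 - (0 : ℤ) - (n : ℤ)) / 2 + 1 / 2)) p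
        simp only [hq] at h2
        refine ⟨q, ?_⟩
        convert h2 using 1
        push_cast; ring
    induction m with
    | zero => exact h1
    | succ m ih =>
      obtain ⟨p, hp⟩ := ih
      have h2 := hp.lowerBoth (nonResonant_oct n m) (hd p)
      obtain ⟨q, hq⟩ := exists_polynomial_lowerBeta (-1 / 12 - (m : ℤ) - (n : ℤ))
        (3 / 4 - (m : ℤ) - 1) p
      simp only [hq] at h2
      refine ⟨q, ?_⟩
      convert h2 using 1 <;> push_cast <;> ring
  obtain ⟨p, hp⟩ := key
  exact ⟨p, isOctahedral_iff.2 (hp.congr (by simp))⟩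

/-- The order of vanishing at the origin and the leading coefficient are well-defined. -/
theorem eq_of_mul_pow_eventuallyEq {a b : ℂ → ℂ} {k l : ℕ} (ha : ContinuousAt a 0)
    (hb : ContinuousAt b 0) (ha0 : a 0 ≠ 0) (hb0 : b 0 ≠ 0)
    (h : ∀ᶠ u in 𝓝[≠] (0 : ℂ), a u * u ^ k = b u * u ^ l) : k = l ∧ a 0 = b 0 := by
  have key : ∀ {a b : ℂ → ℂ} {k l : ℕ}, ContinuousAt a 0 → ContinuousAt b 0 → k ≤ l →
      (∀ᶠ u in 𝓝[≠] (0 : ℂ), a u * u ^ k = b u * u ^ l) → a 0 = b 0 * 0 ^ (l - k) := by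
    intro a b k l ha hb hkl h
    have h1 : ∀ᶠ u in 𝓝[≠] (0 : ℂ), a u = b u * u ^ (l - k) := by
      filter_upwards [h, self_mem_nhdsWithin] with u hu hu0
      have hu0 : u ≠ 0 := hu0
      apply mul_right_cancel₀ (pow_ne_zero k hu0)
      rw [hu, mul_assoc, ← pow_add, Nat.sub_add_cancel hkl]
    exact tendsto_nhds_unique ((ha.tendsto.mono_left nhdsWithin_le_nhds).congr' h1)
      ((hb.mul (continuousAt_id.pow (l - k))).tendsto.mono_left nhdsWithin_le_nhds)
  have hkl : k = l := by
    rcases lt_trichotomy k l with hlt | heq | hlt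
    · exact absurd (by rw [key ha hb hlt.le h, zero_pow (by omega), mul_zero]) ha0
    · exact heq
    · exact absurd (by rw [key hb ha hlt.le (h.mono fun u hu => hu.symm), zero_pow (by omega),
        mul_zero]) hb0
  refine ⟨hkl, ?_⟩
  subst hkl
  simpa using key ha hb le_rfl h

theorem eval_reverse_eq_mul (p : Polynomial ℂ) {u : ℂ} (hu : u ≠ 0) :
    p.reverse.eval u = u ^ p.natDegree * p.eval u⁻¹ := by
  let _ : Invertible u⁻¹ := invertibleOfNonzero (inv_ne_zero hu)
  have h := Polynomial.eval₂_reverse_mul_pow (RingHom.id ℂ) u⁻¹ p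
  rw [invOf_eq_inv, inv_inv] at h
  simp only [Polynomial.eval₂_id] at h
  rw [← h, inv_pow]
  field_simp

/-- The inversion is regular with value `1` at the origin only if the polynomial has degree
`3 n + 2 m` and leading coefficient `d^m_n`. -/
theorem natDegree_of_conjRat {n m : ℤ} (hn : 0 ≤ n) (hm : 0 ≤ m) {p : Polynomial ℂ}
    (hp : p ≠ 0)
    (h : ratValue (conjRat n m (algebraMap (Polynomial ℂ) (RatFunc ℂ) p)) 0 = 1) :
    p.natDegree = (3 * n + 2 * m).toNat ∧ p.leadingCoeff = octLead n m := by
  have hd := octLead_ne_zero n m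
  have hN : ((3 * n + 2 * m).toNat : ℤ) = 3 * n + 2 * m := Int.toNat_of_nonneg (by omega)
  have h1 := eq_of_mul_pow_eventuallyEq (k := p.natDegree) (l := (3 * n + 2 * m).toNat)
    (a := fun u => octLead n m *
      ratValue (conjRat n m (algebraMap (Polynomial ℂ) (RatFunc ℂ) p)) u)
    (b := fun u => p.reverse.eval u)
    ((continuousAt_ratValue (h ▸ one_ne_zero)).const_mul _) p.reverse.continuous.continuousAt
    (by simpa [h] using hd)
    (by simpa [← Polynomial.coeff_zero_eq_eval_zero, Polynomial.coeff_zero_reverse] using hp) ?_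
  · refine ⟨h1.1, ?_⟩
    have := h1.2
    rw [h, ← Polynomial.coeff_zero_eq_eval_zero, Polynomial.coeff_zero_reverse, mul_one] at this
    exact this.symm
  · filter_upwards [nhdsNE_le_cofinite 0 (ratValue_conjRat n m (algebraMap _ _ p)),
      self_mem_nhdsWithin] with u hu hu0
    rw [hu, eval_reverse_eq_mul p hu0, ratValue_algebraMap, ← hN, zpow_natCast]
    simp only [Int.toNat_natCast]
    field_simp

theorem conjRat_algebraMap {n m : ℤ} (hn : 0 ≤ n) (hm : 0 ≤ m) {p : Polynomial ℂ}
    (hp : p.natDegree = (3 * n + 2 * m).toNat) :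
    conjRat n m (algebraMap (Polynomial ℂ) (RatFunc ℂ) p) =
      algebraMap (Polynomial ℂ) (RatFunc ℂ) (Polynomial.C (octLead n m)⁻¹ * p.reverse) := by
  have hN : ((3 * n + 2 * m).toNat : ℤ) = 3 * n + 2 * m := Int.toNat_of_nonneg (by omega)
  apply ratFunc_eq_of_frequently
  refine Eventually.frequently ?_
  filter_upwards [ratValue_conjRat n m (algebraMap (Polynomial ℂ) (RatFunc ℂ) p),
    eventually_cofinite_ne 0] with u hu hu0
  rw [hu, ratValue_algebraMap, ratValue_algebraMap, Polynomial.eval_mul, Polynomial.eval_C,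
    eval_reverse_eq_mul p hu0, hp, ← zpow_natCast, hN, mul_assoc]

theorem theorem1 (n m : ℤ) :
    -- the octahedral function and its conjugate are well-defined rational functions
    (∃! r : RatFunc ℂ, IsOctahedral n m r) ∧
    (∃! s : RatFunc ℂ, IsOctahedralConj n m s) ∧
    ∀ r s : RatFunc ℂ, IsOctahedral n m r → IsOctahedralConj n m s →
      -- (i) the polynomial case
      (0 ≤ n → 0 ≤ m → ∃ p : Polynomial ℂ,
        r = algebraMap (Polynomial ℂ) (RatFunc ℂ) p ∧
        (p.natDegree : ℤ) = 3 * n + 2 * m ∧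
        p.coeff 0 = 1 ∧
        p.coeff (3 * n + 2 * m).toNat = octLead n m ∧
        s = algebraMap (Polynomial ℂ) (RatFunc ℂ)
          (Polynomial.C (octLead n m)⁻¹ * p.reverse) ∧
        (Polynomial.C (octLead n m)⁻¹ * p.reverse).coeff 0 = 1) ∧
      -- (ii) the value at the origin and the asymptotics at infinity
      ratValue r 0 = 1 ∧
      octLead n m ≠ 0 ∧
      Asymptotics.IsEquivalent (Bornology.cobounded ℂ) (ratValue r)
        (fun u : ℂ => octLead n m * u ^ (3 * n + 2 * m)) ∧
      -- (iii) the conjugate, as an identity between rational functions of the indeterminate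
      s = RatFunc.C (octLead n m)⁻¹ * RatFunc.X ^ (3 * n + 2 * m) *
        r.eval RatFunc.C (RatFunc.X : RatFunc ℂ)⁻¹ := by
  obtain ⟨r₀, h₀⟩ := exists_isOctPair n m
  have hd := octLead_ne_zero n m
  refine ⟨⟨r₀, h₀.isOctahedral, fun r hr => hr.unique h₀.isOctahedral⟩,
    ⟨conjRat n m r₀, h₀.isOctahedralConj, fun s hs => hs.unique h₀.isOctahedralConj⟩, ?_⟩
  intro r s hr hs
  obtain rfl := hr.unique h₀.isOctahedral
  obtain rfl := hs.unique h₀.isOctahedralConj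
  refine ⟨fun hn hm => ?_, hr.ratValue_zero, hd, isEquivalent_of_conjRat hs.ratValue_zero, rfl⟩
  obtain ⟨p, hp⟩ := exists_polynomial_isOctahedral n.toNat m.toNat
  rw [Int.toNat_of_nonneg hn, Int.toNat_of_nonneg hm] at hp
  obtain rfl := hr.unique hp
  have hp0 : p.coeff 0 = 1 := by
    have := hr.ratValue_zero
    rwa [ratValue_algebraMap, ← Polynomial.coeff_zero_eq_eval_zero] at this
  have hpne : p ≠ 0 := fun h => by simp [h] at hp0
  obtain ⟨hdeg, hlead⟩ := natDegree_of_conjRat hn hm hpne hs.ratValue_zero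
  refine ⟨p, rfl, by rw [hdeg, Int.toNat_of_nonneg (by omega)], hp0, ?_,
    conjRat_algebraMap hn hm hdeg, ?_⟩
  · rw [← hdeg, Polynomial.coeff_natDegree, hlead]
  · rw [Polynomial.coeff_C_mul, Polynomial.coeff_zero_reverse, hlead, inv_mul_cancel₀ hd]
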